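/- Let $\mathcal{Y}$ be a finite set, and let $\mu \neq \pi$ be two probability mass functions (pmfs) on $\mathcal{Y}$, both with full support. For pmfs $p,q$ on $\mathcal{Y}$ put $B(p,q) = -\log \sum_{y} \sqrt{p(y)q(y)}$ and $D(p\|q) = \sum_y p(y)\log\frac{p(y)}{q(y)}$, and let $C_\pi = -\log \min_{y} \pi(y) < \infty$. For $M \ge 3$ and $n \ge 1$ let $\mathbf{y}^{(i)} = (y^{(i)}_1,\dots,y^{(i)}_n) \in \mathcal{Y}^n$, $i=1,\dots,M$, be $n$ observations of $M$ coordinates. Under hypothesis $i \in \{1,\dots,M\}$ all $Mn$ observations are independent, those in coordinate $i$ (the outlier) have law $\mu$ and those in the other coordinates have law $\pi$; write $\mathbb{P}_i$ for this distribution. A test is a sequence of maps $\delta_n : \mathcal{Y}^{Mn} \to \{1,\dots,M\}$; its maximal error probability is $e_n(\delta) = \max_{i} \mathbb{P}_i\{\delta_n \neq i\}$ and its error exponent is $\lim_{n\to\infty} -\frac1n \log e_n(\delta)$, if this limit exists. Let $\gamma_i$ be the empirical distribution of $\mathbf{y}^{(i)}$. The universal test, which does not use $\mu$ or $\pi$,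 decides for an index $i$ that minimizes $$U_i^{\mathrm{univ}} = \sum_{j \ne i} D\Big(\gamma_j \,\Big\|\, \tfrac{1}{M-1}\textstyle\sum_{k\neq i}\gamma_k\Big),$$ ties being broken arbitrarily. **Theorem.** For each $M \ge 3$ the error exponent $\alpha_M$ of the universal test exists and satisfies $$\alpha_M \ \ge\ \beta_M := \min\Big\{\, 2B(\mu,q) \ :\ q \text{ a pmf on } \mathcal{Y},\ D(q\|\pi) \le \tfrac{1}{M-1}\big(2B(\mu,\pi)+C_\pi\big) \Big\},$$ where the minimum is attained. The lower bound $\beta_M$ is nondecreasing in $M \ge 3$, and $\beta_M \to 2B(\mu,\pi)$ as $M \to \infty$. Moreover the test is asymptotically efficient: $$\lim_{M\to\infty} \alpha_M = 2B(\mu,\pi),$$ and for every $M\ge 3$ the number $2B(\mu,\pi)$ is the optimal error exponent when $\mu$ and $\pi$ are both known, that is, some test (depending on $\mu,\pi$) has error exponent $2B(\mu,\pi)$, and every test $\delta$ satisfies $\limsup_{n\to\infty} -\frac1n\log e_n(\delta) \le 2B(\mu,\pi)$. -/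

import Mathlib

open Filter Topology

namespace OutlierTest

variable {Y : Type*} [Fintype Y]

/-- Bhattacharyya distance of two pmfs on a finite set. -/
noncomputable def bhattacharyya (p q : Y → ℝ) : ℝ :=
  -Real.log (∑ y, Real.sqrt (p y) * Real.sqrt (q y))

/-- Relative entropy of two pmfs on a finite set, in nats, with the convention `0 log (0 / q) = 0`.
It is only used for pairs in which `q y = 0` forces `p y = 0`: either `q` has full support,
or `q` is an average of pmfs one of which is `p`. -/
noncomputable def relEntropy (p q : Y → ℝ) : ℝ :=
  ∑ y, p y * Real.log (p y / q y)

/-- The constant `C_π = -log (min_y π y)`. -/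
noncomputable def logMinConst (π : Y → ℝ) : ℝ :=
  -Real.log (⨅ y, π y)

/-- The values `2 B(μ, q)` over all pmfs `q` with `D(q ‖ π) ≤ (2 B(μ, π) + C_π) / (M - 1)`. -/
def boundValues (μ π : Y → ℝ) (M : ℕ) : Set ℝ :=
  (fun q : Y → ℝ => 2 * bhattacharyya μ q) ''
    {q | q ∈ stdSimplex ℝ Y ∧
      relEntropy q π ≤ 1 / ((M : ℝ) - 1) * (2 * bhattacharyya μ π + logMinConst π)}

/-- The lower bound on the error exponent (a minimum, by the first part of the theorem). -/
noncomputable def exponentBound (μ π : Y → ℝ) (M : ℕ) : ℝ :=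
  sInf (boundValues μ π M)

/-- `n` observations of each of `M` coordinates: `x i k` is the `k`-th observation
in coordinate `i`. -/
abbrev Sample (Y : Type*) (M n : ℕ) : Type _ := Fin M → Fin n → Y

/-- A test, given for every number `n` of observations: it names the outlier coordinate. -/
abbrev Test (Y : Type*) (M : ℕ) : Type _ := ∀ n : ℕ, Sample Y M n → Fin M

/-- Empirical distribution of a sequence. -/
noncomputable def empirical [DecidableEq Y] {n : ℕ} (s : Fin n → Y) : Y → ℝ :=
  fun y => ((Finset.univ.filter fun k => s k = y).card : ℝ) / (n : ℝ)

/-- The average of the empirical distributions of all coordinates but the `i`-th. -/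
noncomputable def avgExcept [DecidableEq Y] {M n : ℕ} (x : Sample Y M n) (i : Fin M) : Y → ℝ :=
  fun y => (∑ k ∈ Finset.univ.erase i, empirical (x k) y) / ((M : ℝ) - 1)

/-- The statistic `U_i^univ`. -/
noncomputable def univStat [DecidableEq Y] {M n : ℕ} (x : Sample Y M n) (i : Fin M) : ℝ :=
  ∑ j ∈ Finset.univ.erase i, relEntropy (empirical (x j)) (avgExcept x i)

/-- `δ` decides for a minimizer of `U_i^univ`, ties being broken arbitrarily. -/
def IsUniversalTest [DecidableEq Y] {M : ℕ} (δ : Test Y M) : Prop :=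
  ∀ (n : ℕ) (x : Sample Y M n) (i : Fin M), univStat x (δ n x) ≤ univStat x i

/-- Probability of the sample `x` when coordinate `i` is the outlier. -/
def sampleProb (μ π : Y → ℝ) {M n : ℕ} (i : Fin M) (x : Sample Y M n) : ℝ :=
  ∏ k, (μ (x i k) * ∏ j ∈ Finset.univ.erase i, π (x j k))

/-- Maximal error probability of `δ` with `n` observations. -/
noncomputable def maxError (μ π : Y → ℝ) {M : ℕ} (δ : Test Y M) (n : ℕ) : ℝ :=
  ⨆ i : Fin M, ∑ x : Sample Y M n with δ n x ≠ i, sampleProb μ π i x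

/-- `-(1/n) log e`, where `e` is the maximal error probability with `n` observations. -/
noncomputable def errorRate (μ π : Y → ℝ) {M : ℕ} (δ : Test Y M) (n : ℕ) : ℝ :=
  -(1 / (n : ℝ)) * Real.log (maxError μ π δ n)

/-- The error exponent of `δ` exists and equals `a`. -/
def HasErrorExponent (μ π : Y → ℝ) {M : ℕ} (δ : Test Y M) (a : ℝ) : Prop :=
  Tendsto (errorRate μ π δ) atTop (𝓝 a)

/-- `a` is the optimal error exponent among all tests with `M` coordinates when `μ` and `π` are
known: some test (which may depend on `μ` and `π`) has exponent `a`, and the upper limit of the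
error rate of any test is at most `a`. -/
def IsOptimalExponent (μ π : Y → ℝ) (M : ℕ) (a : ℝ) : Prop :=
  (∃ δ : Test Y M, HasErrorExponent μ π δ a) ∧
    ∀ δ : Test Y M, ∀ ε : ℝ, 0 < ε → ∀ᶠ n in atTop, errorRate μ π δ n ≤ a + ε

end OutlierTest

namespace OutlierTest

section RelativeEntropy

variable {Y : Type*} [Fintype Y]

lemma sub_le_mul_log_div {a c : ℝ} (ha : 0 ≤ a) (hc : 0 ≤ c) (h : c = 0 → a = 0) :
    a - c ≤ a * Real.log (a / c) := by
  rcases ha.eq_or_lt with rfl | ha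
  · simpa using hc
  have hc' : 0 < c := lt_of_le_of_ne hc fun e => ha.ne' (h e.symm)
  have h1 := Real.one_sub_inv_le_log_of_pos (div_pos ha hc')
  have h2 := mul_le_mul_of_nonneg_left h1 ha.le
  have h3 : a * (1 - (a / c)⁻¹) = a - c := by field_simp
  linarith

lemma log_sum_inequality {a b c : ℝ} (ha : 0 ≤ a) (hb : 0 ≤ b) (hc : 0 ≤ c)
    (h : c = 0 → a = 0) :
    (a + b) * Real.log ((a + b) / (c + b)) ≤ a * Real.log (a / c) := by
  rcases ha.eq_or_lt with rfl | ha
  · rcases hb.eq_or_lt with rfl | hb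
    · simp
    · have h1 : (0 + b) / (c + b) ≤ 1 := by
        rw [div_le_one (by linarith)]; linarith
      have h2 : Real.log ((0 + b) / (c + b)) ≤ 0 :=
        Real.log_nonpos (by positivity) h1
      have := mul_nonpos_of_nonneg_of_nonpos hb.le h2
      simpa using this
  have hc' : 0 < c := lt_of_le_of_ne hc fun e => ha.ne' (h e.symm)
  set r := (a + b) / (c + b) with hr
  have hr0 : 0 < r := by positivity
  have hr1 : (c + b) * r = a + b := by rw [hr]; field_simp
  have h1 := sub_le_mul_log_div (a := a) (c := c * r) ha.le (by positivity)
    (fun e => absurd e (by positivity))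
  have h2 : Real.log (a / (c * r)) = Real.log (a / c) - Real.log r := by
    rw [← div_div, Real.log_div (by positivity) hr0.ne']
  have h3 : b * Real.log r ≤ b * (r - 1) :=
    mul_le_mul_of_nonneg_left (Real.log_le_sub_one_of_pos hr0) hb
  rw [h2] at h1
  nlinarith

lemma relEntropy_self (p : Y → ℝ) : relEntropy p p = 0 := by
  refine Finset.sum_eq_zero fun y _ => ?_
  by_cases h : p y = 0
  · simp [h]
  · simp [div_self h]

lemma sum_sq_sqrt_sub_le_relEntropy {p q : Y → ℝ} (hp : p ∈ stdSimplex ℝ Y)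
    (hq : q ∈ stdSimplex ℝ Y) (h : ∀ y, q y = 0 → p y = 0) :
    ∑ y, (√(p y) - √(q y)) ^ 2 ≤ relEntropy p q := by
  have key : ∀ y, (√(p y) - √(q y)) ^ 2 + p y - q y ≤ p y * Real.log (p y / q y) := by
    intro y
    have h1 := sub_le_mul_log_div (Real.sqrt_nonneg (p y)) (Real.sqrt_nonneg (q y))
      (fun e => by rw [h y ((Real.sqrt_eq_zero (hq.1 y)).1 e), Real.sqrt_zero])
    have h2 : Real.log (√(p y) / √(q y)) = Real.log (p y / q y) / 2 := by
      rw [← Real.sqrt_div (hp.1 y), Real.log_sqrt (div_nonneg (hp.1 y) (hq.1 y))]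
    rw [h2] at h1
    have h3 := mul_le_mul_of_nonneg_left h1 (Real.sqrt_nonneg (p y))
    have h4 := Real.mul_self_sqrt (hp.1 y)
    have h5 := Real.mul_self_sqrt (hq.1 y)
    have h6 : √(p y) * (√(p y) * (Real.log (p y / q y) / 2))
        = p y * Real.log (p y / q y) / 2 := by rw [← mul_assoc, h4]; ring
    nlinarith
  have := Finset.sum_le_sum fun y (_ : y ∈ Finset.univ) => key y
  rw [Finset.sum_sub_distrib, Finset.sum_add_distrib, hp.2, hq.2] at this
  simpa [relEntropy] using this

lemma relEntropy_nonneg {p q : Y → ℝ} (hp : p ∈ stdSimplex ℝ Y)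
    (hq : q ∈ stdSimplex ℝ Y) (h : ∀ y, q y = 0 → p y = 0) : 0 ≤ relEntropy p q :=
  (Finset.sum_nonneg fun _ _ => sq_nonneg _).trans (sum_sq_sqrt_sub_le_relEntropy hp hq h)

lemma sq_sqrt_sub_le_relEntropy {p q : Y → ℝ} (hp : p ∈ stdSimplex ℝ Y)
    (hq : q ∈ stdSimplex ℝ Y) (h : ∀ y, q y = 0 → p y = 0) (y : Y) :
    (√(p y) - √(q y)) ^ 2 ≤ relEntropy p q :=
  (Finset.single_le_sum (f := fun y => (√(p y) - √(q y)) ^ 2) (fun _ _ => sq_nonneg _)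
    (Finset.mem_univ y)).trans (sum_sq_sqrt_sub_le_relEntropy hp hq h)

lemma le_one_of_mem_stdSimplex {p : Y → ℝ} (hp : p ∈ stdSimplex ℝ Y) (y : Y) : p y ≤ 1 := by
  rw [← hp.2]
  exact Finset.single_le_sum (fun y _ => hp.1 y) (Finset.mem_univ y)

lemma sq_sub_le_relEntropy {p q : Y → ℝ} (hp : p ∈ stdSimplex ℝ Y)
    (hq : q ∈ stdSimplex ℝ Y) (h : ∀ y, q y = 0 → p y = 0) (y : Y) :
    (p y - q y) ^ 2 / 4 ≤ relEntropy p q := by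
  refine le_trans ?_ (sq_sqrt_sub_le_relEntropy hp hq h y)
  have h1 := Real.mul_self_sqrt (hp.1 y)
  have h2 := Real.mul_self_sqrt (hq.1 y)
  have h3 : √(p y) ≤ 1 := Real.sqrt_le_one.2 (le_one_of_mem_stdSimplex hp y)
  have h4 : √(q y) ≤ 1 := Real.sqrt_le_one.2 (le_one_of_mem_stdSimplex hq y)
  have h5 : p y - q y = (√(p y) - √(q y)) * (√(p y) + √(q y)) := by
    linarith [mul_comm (√(p y)) (√(q y))]
  have h6 : (√(p y) + √(q y)) ^ 2 ≤ 4 := by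
    nlinarith [Real.sqrt_nonneg (p y), Real.sqrt_nonneg (q y)]
  rw [h5, mul_pow]
  nlinarith [sq_nonneg (√(p y) - √(q y))]

lemma relEntropy_pos {p q : Y → ℝ} (hp : p ∈ stdSimplex ℝ Y)
    (hq : q ∈ stdSimplex ℝ Y) (h : ∀ y, q y = 0 → p y = 0) (hne : p ≠ q) :
    0 < relEntropy p q := by
  obtain ⟨y, hy⟩ := Function.ne_iff.1 hne
  have := sq_sub_le_relEntropy hp hq h y
  have h2 : 0 < (p y - q y) ^ 2 := (sq_nonneg _).lt_of_ne' (pow_ne_zero 2 (sub_ne_zero.2 hy))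
  linarith

lemma two_mul_bhattacharyya_le {p μ q : Y → ℝ} (hp : p ∈ stdSimplex ℝ Y)
    (hμ : ∀ y, 0 < μ y) (hq : ∀ y, 0 ≤ q y) (h : ∀ y, q y = 0 → p y = 0) :
    2 * bhattacharyya μ q ≤ relEntropy p μ + relEntropy p q := by
  set Z := ∑ y, √(μ y) * √(q y) with hZ
  have hZ0 : 0 < Z := by
    obtain ⟨y, hy⟩ : ∃ y, p y ≠ 0 := by
      by_contra! hc
      have := hp.2
      simp [hc] at this
    refine Finset.sum_pos' (fun y _ => by positivity) ⟨y, Finset.mem_univ y, ?_⟩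
    have : 0 < q y := lt_of_le_of_ne (hq y) fun e => hy (h y e.symm)
    have := hμ y
    positivity
  have key : ∀ y, 2 * (p y * (-Real.log Z) + p y - √(μ y) * √(q y) / Z)
      ≤ p y * Real.log (p y / μ y) + p y * Real.log (p y / q y) := by
    intro y
    rcases (hp.1 y).eq_or_lt with h0 | h0
    · rw [← h0]
      have : 0 ≤ √(μ y) * √(q y) / Z := by positivity
      simp only [zero_mul, zero_add]
      linarith
    have hqy : 0 < q y := lt_of_le_of_ne (hq y) fun e => h0.ne' (h y e.symm)
    have hμy := hμ y
    have h1 := sub_le_mul_log_div (a := p y) (c := √(μ y) * √(q y) / Z) h0.le (by positivity)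
      (fun e => absurd e (by positivity))
    have h2 : Real.log (p y / (√(μ y) * √(q y) / Z)) =
        Real.log (p y) - (Real.log (μ y) / 2 + Real.log (q y) / 2 - Real.log Z) := by
      rw [Real.log_div (by positivity) (by positivity), Real.log_div (by positivity) (by positivity),
        Real.log_mul (by positivity) (by positivity), Real.log_sqrt hμy.le, Real.log_sqrt hqy.le]
    rw [h2] at h1
    rw [Real.log_div (by positivity) (by positivity), Real.log_div (by positivity) (by positivity)]
    nlinarith
  have := Finset.sum_le_sum fun y (_ : y ∈ Finset.univ) => key y
  rw [← Finset.mul_sum, Finset.sum_sub_distrib, Finset.sum_add_distrib, ← Finset.sum_mul,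
    ← Finset.sum_div, ← hZ, div_self hZ0.ne', hp.2, Finset.sum_add_distrib] at this
  simp only [bhattacharyya, relEntropy, ← hZ]
  linarith

lemma sum_relEntropy_eq {ι : Type*} {s : Finset ι} {γ : ι → Y → ℝ} {a q : Y → ℝ} {N : ℝ}
    (hN : 0 < N) (hγ : ∀ k ∈ s, ∀ y, 0 ≤ γ k y) (ha : ∀ y, a y = (∑ k ∈ s, γ k y) / N)
    (hq : ∀ y, q y = 0 → a y = 0) :
    ∑ k ∈ s, relEntropy (γ k) q = ∑ k ∈ s, relEntropy (γ k) a + N * relEntropy a q := by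
  simp only [relEntropy]
  rw [Finset.sum_comm, Finset.sum_comm (s := s), Finset.mul_sum, ← Finset.sum_add_distrib]
  refine Finset.sum_congr rfl fun y _ => ?_
  have hs : ∑ k ∈ s, γ k y = N * a y := by rw [ha]; field_simp
  by_cases h0 : a y = 0
  · have hz : ∀ k ∈ s, γ k y = 0 :=
      (Finset.sum_eq_zero_iff_of_nonneg fun k hk => hγ k hk y).1 (by rw [hs, h0, mul_zero])
    rw [h0, Finset.sum_eq_zero fun k hk => by rw [hz k hk, zero_mul],
      Finset.sum_eq_zero fun k hk => by rw [hz k hk, zero_mul]]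
    simp
  · have hq0 : q y ≠ 0 := fun e => h0 (hq y e)
    rw [← mul_assoc, ← hs, Finset.sum_mul, ← Finset.sum_add_distrib]
    refine Finset.sum_congr rfl fun k _ => ?_
    by_cases hk : γ k y = 0
    · simp [hk]
    · rw [Real.log_div hk hq0, Real.log_div hk h0, Real.log_div h0 hq0]; ring

lemma relEntropy_mix_le {u v w : Y → ℝ} (hu : ∀ y, 0 ≤ u y) (hv : ∀ y, 0 ≤ v y)
    (hw : ∀ y, 0 ≤ w y) (h : ∀ y, v y = 0 → u y = 0) {t : ℝ} (ht0 : 0 ≤ t) (ht1 : t < 1) :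
    relEntropy (fun y => (1 - t) * u y + t * w y) (fun y => (1 - t) * v y + t * w y)
      ≤ (1 - t) * relEntropy u v := by
  have h1 : 0 < 1 - t := by linarith
  simp only [relEntropy, Finset.mul_sum]
  refine Finset.sum_le_sum fun y _ => ?_
  have := log_sum_inequality (a := (1 - t) * u y) (b := t * w y) (c := (1 - t) * v y)
    (mul_nonneg h1.le (hu y)) (mul_nonneg ht0 (hw y)) (mul_nonneg h1.le (hv y))
    (fun e => by rw [h y ((mul_eq_zero.1 e).resolve_left h1.ne'), mul_zero])
  rwa [mul_div_mul_left _ _ h1.ne', mul_assoc (1 - t)] at this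

lemma continuous_relEntropy_left {q : Y → ℝ} (hq : ∀ y, q y ≠ 0) :
    Continuous fun p : Y → ℝ => relEntropy p q := by
  have : (fun p : Y → ℝ => relEntropy p q) =
      fun p => ∑ y, (p y * Real.log (p y) - p y * Real.log (q y)) := by
    funext p
    refine Finset.sum_congr rfl fun y _ => ?_
    by_cases h : p y = 0
    · simp [h]
    · rw [Real.log_div h (hq y)]; ring
  rw [this]
  refine continuous_finsetSum _ fun y _ => ?_
  exact (Real.continuous_mul_log.comp (continuous_apply y)).sub
    ((continuous_apply y).mul continuous_const)

lemma logMinConst_ge {π : Y → ℝ} (hπ : ∀ y, 0 < π y) (y : Y) :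
    -Real.log (π y) ≤ logMinConst π := by
  have : Nonempty Y := ⟨y⟩
  obtain ⟨z, hz⟩ := exists_eq_ciInf_of_finite (f := π)
  have h1 : (⨅ y, π y) ≤ π y := ciInf_le (Set.finite_range π).bddBelow y
  have h2 : 0 < ⨅ y, π y := hz ▸ hπ z
  exact neg_le_neg (Real.log_le_log h2 h1)

lemma relEntropy_le_logMinConst {p π : Y → ℝ} (hp : p ∈ stdSimplex ℝ Y)
    (hπ : ∀ y, 0 < π y) : relEntropy p π ≤ logMinConst π := by
  have : ∀ y, p y * Real.log (p y / π y) ≤ p y * logMinConst π := by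
    intro y
    rcases (hp.1 y).eq_or_lt with h | h
    · simp [← h]
    · refine mul_le_mul_of_nonneg_left ?_ h.le
      rw [Real.log_div h.ne' (hπ y).ne']
      linarith [Real.log_nonpos h.le (le_one_of_mem_stdSimplex hp y), logMinConst_ge hπ y]
  calc relEntropy p π ≤ ∑ y, p y * logMinConst π := Finset.sum_le_sum fun y _ => this y
    _ = logMinConst π := by rw [← Finset.sum_mul, hp.2, one_mul]

lemma logMinConst_nonneg {π : Y → ℝ} (hπ : π ∈ stdSimplex ℝ Y) (hpos : ∀ y, 0 < π y) :
    0 ≤ logMinConst π :=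
  (relEntropy_self π).ge.trans (relEntropy_le_logMinConst hπ hpos)

lemma sum_sqrt_pos {μ q : Y → ℝ} (hμ : ∀ y, 0 < μ y) (hq : q ∈ stdSimplex ℝ Y) :
    0 < ∑ y, √(μ y) * √(q y) := by
  obtain ⟨y, hy⟩ : ∃ y, 0 < q y := by
    by_contra! hc
    have h1 := hq.2
    have h2 : ∑ y, q y ≤ 0 := Finset.sum_nonpos fun y _ => hc y
    linarith
  refine Finset.sum_pos' (fun y _ => by positivity) ⟨y, Finset.mem_univ y, ?_⟩
  have := hμ y
  positivity

lemma sum_sqrt_le_one {μ q : Y → ℝ} (hμ : μ ∈ stdSimplex ℝ Y) (hq : q ∈ stdSimplex ℝ Y) :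
    ∑ y, √(μ y) * √(q y) ≤ 1 := by
  have : ∀ y, √(μ y) * √(q y) ≤ (μ y + q y) / 2 := fun y => by
    nlinarith [sq_nonneg (√(μ y) - √(q y)), Real.mul_self_sqrt (hμ.1 y),
      Real.mul_self_sqrt (hq.1 y)]
  calc _ ≤ ∑ y, (μ y + q y) / 2 := Finset.sum_le_sum fun y _ => this y
    _ = 1 := by rw [← Finset.sum_div, Finset.sum_add_distrib, hμ.2, hq.2]; norm_num

lemma bhattacharyya_nonneg {μ q : Y → ℝ} (hμ : μ ∈ stdSimplex ℝ Y) (hq : q ∈ stdSimplex ℝ Y) :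
    0 ≤ bhattacharyya μ q :=
  neg_nonneg.2 (Real.log_nonpos (Finset.sum_nonneg fun y _ => by positivity)
    (sum_sqrt_le_one hμ hq))

lemma continuousOn_bhattacharyya {μ : Y → ℝ} (hμ : ∀ y, 0 < μ y) :
    ContinuousOn (fun q : Y → ℝ => bhattacharyya μ q) (stdSimplex ℝ Y) := by
  refine (ContinuousOn.log ?_ fun q hq => (sum_sqrt_pos hμ hq).ne').neg
  exact (continuous_finsetSum _ fun y _ => continuous_const.mul
    (Real.continuous_sqrt.comp (continuous_apply y))).continuousOn

section Bound

variable {μ π : Y → ℝ}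

lemma bound_radius_nonneg (hμ : μ ∈ stdSimplex ℝ Y) (hπ : π ∈ stdSimplex ℝ Y)
    (hπ_pos : ∀ y, 0 < π y) : 0 ≤ 2 * bhattacharyya μ π + logMinConst π := by
  have := bhattacharyya_nonneg hμ hπ
  have := logMinConst_nonneg hπ hπ_pos
  positivity

lemma two_mul_bhattacharyya_mem_boundValues (hμ : μ ∈ stdSimplex ℝ Y) (hπ : π ∈ stdSimplex ℝ Y)
    (hπ_pos : ∀ y, 0 < π y) {M : ℕ} (hM : 3 ≤ M) :
    2 * bhattacharyya μ π ∈ boundValues μ π M := by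
  refine ⟨π, ⟨hπ, ?_⟩, rfl⟩
  rw [relEntropy_self]
  have h1 := bound_radius_nonneg hμ hπ hπ_pos
  have h2 : (3 : ℝ) ≤ M := by exact_mod_cast hM
  have h3 : 0 < (M : ℝ) - 1 := by linarith
  positivity

lemma isLeast_exponentBound (hμ : μ ∈ stdSimplex ℝ Y) (hμ_pos : ∀ y, 0 < μ y)
    (hπ : π ∈ stdSimplex ℝ Y) (hπ_pos : ∀ y, 0 < π y) {M : ℕ} (hM : 3 ≤ M) :
    IsLeast (boundValues μ π M) (exponentBound μ π M) := by
  have hc : IsCompact (boundValues μ π M) := by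
    refine IsCompact.image_of_continuousOn ?_ ?_
    · exact (isCompact_stdSimplex ℝ Y).inter_right
        (isClosed_le (continuous_relEntropy_left fun y => (hπ_pos y).ne') continuous_const)
    · exact (continuousOn_const.mul (continuousOn_bhattacharyya hμ_pos)).mono fun q hq => hq.1
  exact hc.isLeast_sInf ⟨_, two_mul_bhattacharyya_mem_boundValues hμ hπ hπ_pos hM⟩

lemma monotoneOn_exponentBound (hμ : μ ∈ stdSimplex ℝ Y) (hμ_pos : ∀ y, 0 < μ y)
    (hπ : π ∈ stdSimplex ℝ Y) (hπ_pos : ∀ y, 0 < π y) :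
    MonotoneOn (exponentBound μ π) (Set.Ici 3) := by
  intro M hM N hN hMN
  obtain ⟨q, ⟨hq, hq2⟩, hq3⟩ := (isLeast_exponentBound hμ hμ_pos hπ hπ_pos hN).1
  rw [← hq3]
  refine (isLeast_exponentBound hμ hμ_pos hπ hπ_pos hM).2 ⟨q, ⟨hq, hq2.trans ?_⟩, rfl⟩
  have h1 := bound_radius_nonneg hμ hπ hπ_pos
  have h2 : (3 : ℝ) ≤ M := by exact_mod_cast hM
  have h3 : (M : ℝ) ≤ N := by exact_mod_cast hMN
  exact mul_le_mul_of_nonneg_right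
    (one_div_le_one_div_of_le (by linarith) (by linarith)) h1

lemma tendsto_exponentBound (hμ : μ ∈ stdSimplex ℝ Y) (hμ_pos : ∀ y, 0 < μ y)
    (hπ : π ∈ stdSimplex ℝ Y) (hπ_pos : ∀ y, 0 < π y) :
    Tendsto (exponentBound μ π) atTop (𝓝 (2 * bhattacharyya μ π)) := by
  set K := 2 * bhattacharyya μ π + logMinConst π with hK
  set Z := ∑ y, √(μ y) * √(π y) with hZ
  have hZ0 : 0 < Z := sum_sqrt_pos hμ_pos hπ
  set c := ∑ y, √(μ y) with hc
  have hlow : Tendsto (fun M : ℕ => 2 * -Real.log (Z + c * √(1 / ((M : ℝ) - 1) * K))) atTop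
      (𝓝 (2 * bhattacharyya μ π)) := by
    have h1 : Tendsto (fun M : ℕ => 1 / ((M : ℝ) - 1)) atTop (𝓝 0) := by
      simp only [one_div]
      exact tendsto_inv_atTop_zero.comp
        (tendsto_atTop_add_const_right _ (-1 : ℝ) tendsto_natCast_atTop_atTop)
    have h2 : Tendsto (fun M : ℕ => Z + c * √(1 / ((M : ℝ) - 1) * K)) atTop (𝓝 Z) := by
      have := (((Real.continuous_sqrt.tendsto _).comp (h1.mul_const K)).const_mul c).const_add Z
      simpa using this
    exact ((h2.log hZ0.ne').neg).const_mul 2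
  refine tendsto_of_tendsto_of_tendsto_of_le_of_le' hlow tendsto_const_nhds ?_ ?_
  · filter_upwards [eventually_ge_atTop 3] with M hM
    obtain ⟨q, ⟨hq, hq2⟩, hq3⟩ := (isLeast_exponentBound hμ hμ_pos hπ hπ_pos hM).1
    rw [← hq3]
    refine mul_le_mul_of_nonneg_left (neg_le_neg (Real.log_le_log (sum_sqrt_pos hμ_pos hq) ?_))
      zero_le_two
    rw [hZ, hc, Finset.sum_mul, ← Finset.sum_add_distrib]
    refine Finset.sum_le_sum fun y _ => ?_
    rw [← mul_add]
    refine mul_le_mul_of_nonneg_left ?_ (Real.sqrt_nonneg _)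
    have h1 := (sq_sqrt_sub_le_relEntropy hq hπ (fun y e => absurd e (hπ_pos y).ne') y).trans hq2
    have h2 := (le_abs_self _).trans (Real.abs_le_sqrt h1)
    linarith
  · filter_upwards [eventually_ge_atTop 3] with M hM
    exact (isLeast_exponentBound hμ hμ_pos hπ hπ_pos hM).2
      (two_mul_bhattacharyya_mem_boundValues hμ hπ hπ_pos hM)

end Bound

lemma tendsto_pow_mul_exp (K : ℕ) {a : ℝ} (ha : 0 < a) :
    Tendsto (fun n : ℕ => ((n : ℝ) + 1) ^ K * Real.exp (-(n * a))) atTop (𝓝 0) := by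
  have h1 : Tendsto (fun n : ℕ => a * ((n : ℝ) + 1)) atTop atTop :=
    (tendsto_atTop_add_const_right _ (1 : ℝ) tendsto_natCast_atTop_atTop).const_mul_atTop ha
  have h2 := ((Real.tendsto_pow_mul_exp_neg_atTop_nhds_zero K).comp h1).const_mul
    (Real.exp a / a ^ K)
  rw [mul_zero] at h2
  refine h2.congr fun n => ?_
  have h3 : Real.exp (-(n * a)) = Real.exp a * Real.exp (-(a * (n + 1))) := by
    rw [← Real.exp_add]
    ring_nf
  rw [h3, Function.comp_apply, mul_pow]
  field_simp

end RelativeEntropy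

section ProductLaws

variable {Y : Type*}

/-- Probability of `x` when all observations are independent and those in coordinate `i` have
law `p i`. -/
def productProb {M n : ℕ} (p : Fin M → Y → ℝ) (x : Sample Y M n) : ℝ :=
  ∏ i, ∏ k, p i (x i k)

lemma productProb_nonneg {M n : ℕ} {p : Fin M → Y → ℝ} (hp : ∀ i y, 0 ≤ p i y)
    (x : Sample Y M n) : 0 ≤ productProb p x :=
  Finset.prod_nonneg fun i _ => Finset.prod_nonneg fun _ _ => hp i _

lemma pos_of_productProb_ne_zero {M n : ℕ} {p : Fin M → Y → ℝ} (hp : ∀ i y, 0 ≤ p i y)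
    {x : Sample Y M n} (hx : productProb p x ≠ 0) (i : Fin M) (k : Fin n) : 0 < p i (x i k) := by
  refine lt_of_le_of_ne (hp _ _) fun e => hx ?_
  exact Finset.prod_eq_zero (Finset.mem_univ i) (Finset.prod_eq_zero (Finset.mem_univ k) e.symm)

lemma sum_productProb [Fintype Y] {M n : ℕ} (p : Fin M → Y → ℝ) :
    ∑ x : Sample Y M n, productProb p x = ∏ i, (∑ y, p i y) ^ n := by
  classical
  simp only [productProb]
  rw [← Fintype.piFinset_univ,
    ← Finset.prod_univ_sum (fun _ => Finset.univ) fun i (s : Fin n → Y) => ∏ k, p i (s k)]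
  refine Finset.prod_congr rfl fun i _ => ?_
  rw [← Fintype.piFinset_univ, ← Finset.prod_univ_sum (fun _ => Finset.univ) fun _ y => p i y]
  simp

lemma sum_productProb_eq_one [Fintype Y] {M n : ℕ} {p : Fin M → Y → ℝ}
    (hp : ∀ i, p i ∈ stdSimplex ℝ Y) : ∑ x : Sample Y M n, productProb p x = 1 := by
  rw [sum_productProb]
  exact Finset.prod_eq_one fun i _ => by rw [(hp i).2, one_pow]

variable [DecidableEq Y]

lemma natCast_mul_empirical {n : ℕ} (s : Fin n → Y) (y : Y) :
    (n : ℝ) * empirical s y = ((Finset.univ.filter fun k => s k = y).card : ℝ) := by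
  rcases Nat.eq_zero_or_pos n with rfl | hn
  · simp
  · have : (n : ℝ) ≠ 0 := by positivity
    rw [empirical]
    field_simp

lemma empirical_nonneg {n : ℕ} (s : Fin n → Y) (y : Y) : 0 ≤ empirical s y := by
  unfold empirical
  positivity

lemma empirical_pos {n : ℕ} (s : Fin n → Y) (k : Fin n) : 0 < empirical s (s k) := by
  have hn : 0 < n := k.pos
  refine div_pos ?_ (by exact_mod_cast hn)
  exact_mod_cast Finset.card_pos.2 ⟨k, by simp⟩

lemma empirical_eq_zero {n : ℕ} {s : Fin n → Y} {f : Y → ℝ}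
    (h : ∀ k, f (s k) ≠ 0) {y : Y} (hy : f y = 0) : empirical s y = 0 := by
  rw [empirical, Finset.filter_eq_empty_iff.2 fun k _ e => h k (by rw [e, hy])]
  simp

variable [Fintype Y]

lemma sum_apply_eq {n : ℕ} (s : Fin n → Y) (f : Y → ℝ) :
    ∑ k, f (s k) = n * ∑ y, empirical s y * f y := by
  rw [Finset.mul_sum, ← Finset.sum_fiberwise (s := Finset.univ) (g := s)]
  refine Finset.sum_congr rfl fun y _ => ?_
  rw [← mul_assoc, natCast_mul_empirical,
    Finset.sum_congr rfl (g := fun _ => f y) fun k hk => by rw [(Finset.mem_filter.1 hk).2]]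
  simp

lemma empirical_mem_stdSimplex {n : ℕ} (hn : 0 < n) (s : Fin n → Y) :
    empirical s ∈ stdSimplex ℝ Y := by
  refine ⟨empirical_nonneg s, ?_⟩
  have h := sum_apply_eq s fun _ => 1
  have h2 : (n : ℝ) ≠ 0 := by positivity
  simp only [Finset.sum_const, Finset.card_univ, Fintype.card_fin, nsmul_eq_mul, mul_one] at h
  exact mul_left_cancel₀ h2 (by linarith)

lemma productProb_eq_mul_exp {M n : ℕ} {p q : Fin M → Y → ℝ} {x : Sample Y M n}
    (hp : ∀ i k, 0 < p i (x i k)) (hq : ∀ i k, 0 < q i (x i k)) :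
    productProb p x = productProb q x *
      Real.exp (-(n * ∑ i, ∑ y, empirical (x i) y * Real.log (q i y / p i y))) := by
  rw [Finset.mul_sum, ← Finset.sum_neg_distrib, Real.exp_sum, productProb, productProb,
    ← Finset.prod_mul_distrib]
  refine Finset.prod_congr rfl fun i _ => ?_
  rw [← sum_apply_eq (x i) fun y => Real.log (q i y / p i y), ← Finset.sum_neg_distrib,
    Real.exp_sum, ← Finset.prod_mul_distrib]
  refine Finset.prod_congr rfl fun k _ => ?_
  rw [Real.exp_neg, Real.exp_log (div_pos (hq i k) (hp i k))]
  have := (hq i k).ne'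
  field_simp

lemma productProb_eq_empirical {M n : ℕ} {p : Fin M → Y → ℝ} {x : Sample Y M n}
    (hp : ∀ i k, 0 < p i (x i k)) :
    productProb p x = productProb (fun i => empirical (x i)) x *
      Real.exp (-(n * ∑ i, relEntropy (empirical (x i)) (p i))) :=
  productProb_eq_mul_exp hp fun i k => empirical_pos (x i) k

lemma sum_productProb_empirical_le {M n : ℕ} (hn : 0 < n) :
    ∑ x : Sample Y M n, productProb (fun i => empirical (x i)) x
      ≤ ((n : ℝ) + 1) ^ (Fintype.card Y * M) := by
  classical
  set T : Finset (Fin M → Y → Fin (n + 1)) := Finset.univ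
  let c : Sample Y M n → Fin M → Y → Fin (n + 1) := fun x i y =>
    ⟨(Finset.univ.filter fun k => x i k = y).card,
      Nat.lt_succ_of_le ((Finset.card_le_univ _).trans (by simp))⟩
  let R : (Fin M → Y → Fin (n + 1)) → Fin M → Y → ℝ := fun d i y => ((d i y : ℕ) : ℝ) / n
  have hR : ∀ x, R (c x) = fun i => empirical (x i) := fun x => rfl
  calc ∑ x : Sample Y M n, productProb (fun i => empirical (x i)) x
      ≤ ∑ x : Sample Y M n, ∑ d ∈ Finset.univ.image c, productProb (R d) x := by
        refine Finset.sum_le_sum fun x _ => ?_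
        rw [← hR]
        refine Finset.single_le_sum (f := fun d => productProb (R d) x) (fun d _ => ?_)
          (Finset.mem_image_of_mem c (Finset.mem_univ x))
        exact productProb_nonneg (fun i y => by positivity) x
    _ = ∑ d ∈ Finset.univ.image c, ∑ x : Sample Y M n, productProb (R d) x := Finset.sum_comm
    _ = ∑ d ∈ Finset.univ.image c, (1 : ℝ) := by
        refine Finset.sum_congr rfl fun d hd => ?_
        obtain ⟨z, -, rfl⟩ := Finset.mem_image.1 hd
        exact sum_productProb_eq_one fun i => empirical_mem_stdSimplex hn (z i)
    _ ≤ ((n : ℝ) + 1) ^ (Fintype.card Y * M) := by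
        have h1 : (Finset.univ.image c).card ≤ (n + 1) ^ (Fintype.card Y * M) :=
          (Finset.card_le_univ _).trans (by simp [pow_mul])
        rw [Finset.sum_const, nsmul_eq_mul, mul_one]
        exact_mod_cast h1

lemma sum_productProb_le {M n : ℕ} (hn : 0 < n) {p : Fin M → Y → ℝ} (hp : ∀ i y, 0 ≤ p i y)
    (E : Finset (Sample Y M n)) {a : ℝ}
    (h : ∀ x ∈ E, productProb p x ≠ 0 → a ≤ ∑ i, relEntropy (empirical (x i)) (p i)) :
    ∑ x ∈ E, productProb p x ≤ ((n : ℝ) + 1) ^ (Fintype.card Y * M) * Real.exp (-(n * a)) := by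
  have hnn : ∀ x : Sample Y M n, 0 ≤ productProb (fun i => empirical (x i)) x := fun x =>
    productProb_nonneg (fun i y => empirical_nonneg _ _) x
  calc ∑ x ∈ E, productProb p x
      ≤ ∑ x ∈ E, productProb (fun i => empirical (x i)) x * Real.exp (-(n * a)) := by
        refine Finset.sum_le_sum fun x hx => ?_
        by_cases h0 : productProb p x = 0
        · rw [h0]
          exact mul_nonneg (hnn x) (Real.exp_pos _).le
        · rw [productProb_eq_empirical (pos_of_productProb_ne_zero hp h0)]
          refine mul_le_mul_of_nonneg_left (Real.exp_le_exp.2 (neg_le_neg ?_)) (hnn x)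
          exact mul_le_mul_of_nonneg_left (h x hx h0) (Nat.cast_nonneg n)
    _ = (∑ x ∈ E, productProb (fun i => empirical (x i)) x) * Real.exp (-(n * a)) := by
        rw [Finset.sum_mul]
    _ ≤ _ := by
        refine mul_le_mul_of_nonneg_right ?_ (Real.exp_pos _).le
        exact (Finset.sum_le_univ_sum_of_nonneg hnn).trans (sum_productProb_empirical_le hn)

/-- The samples with an empirical distribution that is off by `η` or more. -/
noncomputable def atypical {M : ℕ} (q : Fin M → Y → ℝ) (η : ℝ) (n : ℕ) :
    Finset (Sample Y M n) :=
  Finset.univ.filter fun x => ∃ i y, η ≤ |empirical (x i) y - q i y|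

lemma tendsto_sum_atypical {M : ℕ} {q : Fin M → Y → ℝ} (hq : ∀ i, q i ∈ stdSimplex ℝ Y)
    {η : ℝ} (hη : 0 < η) :
    Tendsto (fun n => ∑ x ∈ atypical q η n, productProb q x) atTop (𝓝 0) := by
  refine tendsto_of_tendsto_of_tendsto_of_le_of_le' tendsto_const_nhds
    (tendsto_pow_mul_exp (Fintype.card Y * M) (a := η ^ 2 / 4) (by positivity))
    (Eventually.of_forall fun n => Finset.sum_nonneg fun x _ =>
      productProb_nonneg (fun i => (hq i).1) x) ?_
  filter_upwards [eventually_gt_atTop 0] with n hn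
  refine sum_productProb_le hn (fun i => (hq i).1) _ fun x hx h0 => ?_
  obtain ⟨i, y, hiy⟩ := (Finset.mem_filter.1 hx).2
  have hac : ∀ j z, q j z = 0 → empirical (x j) z = 0 := fun j z hz =>
    empirical_eq_zero
      (fun k => (pos_of_productProb_ne_zero (fun i => (hq i).1) h0 j k).ne') hz
  calc η ^ 2 / 4 ≤ (empirical (x i) y - q i y) ^ 2 / 4 := by
        rw [← sq_abs (empirical (x i) y - q i y)]
        gcongr
    _ ≤ relEntropy (empirical (x i)) (q i) :=
        sq_sub_le_relEntropy (empirical_mem_stdSimplex hn _) (hq i) (hac i) y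
    _ ≤ _ := Finset.single_le_sum (f := fun j => relEntropy (empirical (x j)) (q j))
        (fun j _ => relEntropy_nonneg (empirical_mem_stdSimplex hn _) (hq j) (hac j))
        (Finset.mem_univ i)

lemma eventually_le_sum_productProb {M : ℕ} {p q : Fin M → Y → ℝ} (hp : ∀ i y, 0 < p i y)
    (hq : ∀ i, q i ∈ stdSimplex ℝ Y) {c ε : ℝ} (hc : 0 < c) (hε : 0 < ε) :
    ∀ᶠ n : ℕ in atTop, ∀ E : Finset (Sample Y M n), c ≤ ∑ x ∈ E, productProb q x →
      c / 2 * Real.exp (-(n * (∑ i, relEntropy (q i) (p i) + ε))) ≤ ∑ x ∈ E, productProb p x := by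
  set L := ∑ i, ∑ y, |Real.log (q i y / p i y)| with hL
  have hL0 : 0 ≤ L := Finset.sum_nonneg fun i _ => Finset.sum_nonneg fun y _ => abs_nonneg _
  set η := ε / (L + 1) with hη
  have hη0 : 0 < η := by positivity
  have hqn : ∀ {n} (x : Sample Y M n), 0 ≤ productProb q x := fun x =>
    productProb_nonneg (fun i => (hq i).1) x
  filter_upwards [(tendsto_sum_atypical hq hη0).eventually (gt_mem_nhds (half_pos hc))]
    with n hn E hE
  classical
  set D := ∑ i, relEntropy (q i) (p i) with hD
  have h1 : c / 2 ≤ ∑ x ∈ E \ atypical q η n, productProb q x := by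
    have h2 : ∑ x ∈ E, productProb q x ≤ ∑ x ∈ E \ atypical q η n, productProb q x
        + ∑ x ∈ atypical q η n, productProb q x := by
      rw [← Finset.sum_union Finset.sdiff_disjoint, Finset.sdiff_union_self_eq_union]
      exact Finset.sum_le_sum_of_subset_of_nonneg Finset.subset_union_left fun x _ _ => hqn x
    linarith
  calc c / 2 * Real.exp (-(n * (D + ε)))
      ≤ (∑ x ∈ E \ atypical q η n, productProb q x) * Real.exp (-(n * (D + ε))) :=
        mul_le_mul_of_nonneg_right h1 (Real.exp_pos _).le
    _ = ∑ x ∈ E \ atypical q η n, productProb q x * Real.exp (-(n * (D + ε))) :=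
        Finset.sum_mul _ _ _
    _ ≤ ∑ x ∈ E \ atypical q η n, productProb p x := by
        refine Finset.sum_le_sum fun x hx => ?_
        by_cases h0 : productProb q x = 0
        · rw [h0, zero_mul]
          exact productProb_nonneg (fun i y => (hp i y).le) x
        rw [productProb_eq_mul_exp (fun i k => hp i _)
          (pos_of_productProb_ne_zero (fun i => (hq i).1) h0)]
        refine mul_le_mul_of_nonneg_left (Real.exp_le_exp.2 (neg_le_neg ?_)) (hqn x)
        refine mul_le_mul_of_nonneg_left ?_ (Nat.cast_nonneg n)
        have hty : ∀ i y, |empirical (x i) y - q i y| ≤ η := by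
          intro i y
          by_contra! hlt
          exact (Finset.mem_sdiff.1 hx).2 (Finset.mem_filter.2 ⟨Finset.mem_univ x, i, y, hlt.le⟩)
        have h3 : ∑ i, ∑ y, empirical (x i) y * Real.log (q i y / p i y) ≤ D + η * L := by
          rw [hD, hL, Finset.mul_sum, ← Finset.sum_add_distrib]
          refine Finset.sum_le_sum fun i _ => ?_
          rw [relEntropy, Finset.mul_sum, ← Finset.sum_add_distrib]
          refine Finset.sum_le_sum fun y _ => ?_
          have h4 : (empirical (x i) y - q i y) * Real.log (q i y / p i y)
              ≤ η * |Real.log (q i y / p i y)| := by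
            refine (le_abs_self _).trans ?_
            rw [abs_mul]
            exact mul_le_mul_of_nonneg_right (hty i y) (abs_nonneg _)
          linarith
        have h5 : η * L ≤ ε := by
          rw [hη, div_mul_eq_mul_div, div_le_iff₀ (by positivity)]
          nlinarith
        linarith
    _ ≤ ∑ x ∈ E, productProb p x :=
        Finset.sum_le_sum_of_subset_of_nonneg Finset.sdiff_subset fun x _ _ =>
          productProb_nonneg (fun i y => (hp i y).le) x

end ProductLaws

section Hypotheses

variable {Y : Type*}

/-- The laws of the coordinates when `i` is the outlier. -/
def hypLaw (μ π : Y → ℝ) {M : ℕ} (i : Fin M) : Fin M → Y → ℝ :=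
  Function.update (fun _ => π) i μ

lemma hypLaw_self (μ π : Y → ℝ) {M : ℕ} (i : Fin M) : hypLaw μ π i i = μ :=
  Function.update_self ..

lemma hypLaw_of_ne (μ π : Y → ℝ) {M : ℕ} {i k : Fin M} (h : k ≠ i) : hypLaw μ π i k = π :=
  Function.update_of_ne h ..

lemma hypLaw_pos {μ π : Y → ℝ} (hμ : ∀ y, 0 < μ y) (hπ : ∀ y, 0 < π y) {M : ℕ} (i k : Fin M)
    (y : Y) : 0 < hypLaw μ π i k y := by
  by_cases h : k = i
  · rw [h, hypLaw_self]; exact hμ y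
  · rw [hypLaw_of_ne _ _ h]; exact hπ y

lemma sampleProb_eq_productProb (μ π : Y → ℝ) {M n : ℕ} (i : Fin M) (x : Sample Y M n) :
    sampleProb μ π i x = productProb (hypLaw μ π i) x := by
  rw [sampleProb, productProb, Finset.prod_comm]
  refine Finset.prod_congr rfl fun k _ => ?_
  rw [← Finset.mul_prod_erase _ _ (Finset.mem_univ i), hypLaw_self]
  congr 1
  exact Finset.prod_congr rfl fun j hj => by rw [hypLaw_of_ne _ _ (Finset.ne_of_mem_erase hj)]

variable [Fintype Y]

lemma sum_productProb_le_maxError (μ π : Y → ℝ) {M : ℕ} (δ : Test Y M) (n : ℕ) (i : Fin M) :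
    ∑ x : Sample Y M n with δ n x ≠ i, productProb (hypLaw μ π i) x ≤ maxError μ π δ n := by
  simp only [← sampleProb_eq_productProb]
  exact le_ciSup (f := fun i => ∑ x : Sample Y M n with δ n x ≠ i, sampleProb μ π i x)
    (Set.finite_range _).bddAbove i

lemma maxError_le {μ π : Y → ℝ} {M : ℕ} [Nonempty (Fin M)] {δ : Test Y M} {n : ℕ} {b : ℝ}
    (h : ∀ i, ∑ x : Sample Y M n with δ n x ≠ i, productProb (hypLaw μ π i) x ≤ b) :
    maxError μ π δ n ≤ b := by
  simp only [← sampleProb_eq_productProb] at h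
  exact ciSup_le h

lemma errorRate_le_of_exp_le {μ π : Y → ℝ} {M : ℕ} {δ : Test Y M} {n : ℕ} (hn : 0 < n) {a : ℝ}
    (h : Real.exp (-(n * a)) ≤ maxError μ π δ n) : errorRate μ π δ n ≤ a := by
  have h1 := (Real.le_log_iff_exp_le ((Real.exp_pos _).trans_le h)).2 h
  have hn' : (0 : ℝ) < n := by exact_mod_cast hn
  rw [errorRate, neg_mul, one_div_mul_eq_div, neg_le, le_div_iff₀ hn']
  linarith

lemma le_errorRate_of_le_exp {μ π : Y → ℝ} {M : ℕ} {δ : Test Y M} {n : ℕ} (hn : 0 < n) {a : ℝ}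
    (h0 : 0 < maxError μ π δ n) (h : maxError μ π δ n ≤ Real.exp (-(n * a))) :
    a ≤ errorRate μ π δ n := by
  have h1 := (Real.log_le_iff_le_exp h0).2 h
  have hn' : (0 : ℝ) < n := by exact_mod_cast hn
  rw [errorRate, neg_mul, one_div_mul_eq_div, le_neg, div_le_iff₀ hn']
  linarith

lemma eventually_exp_le_maxError {μ π : Y → ℝ} {M : ℕ} {δ : Test Y M} {a c ε : ℝ} (hc : 0 < c)
    (hε : 0 < ε)
    (h : ∀ ε : ℝ, 0 < ε → ∀ᶠ n : ℕ in atTop, c * Real.exp (-(n * (a + ε))) ≤ maxError μ π δ n) :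
    ∀ᶠ n : ℕ in atTop, Real.exp (-(n * (a + ε))) ≤ maxError μ π δ n := by
  filter_upwards [h (ε / 2) (half_pos hε),
    (tendsto_pow_mul_exp 0 (half_pos hε)).eventually (gt_mem_nhds hc)] with n h1 h2
  refine le_trans ?_ h1
  have h3 : Real.exp (-(n * (a + ε))) =
      Real.exp (-(n * (ε / 2))) * Real.exp (-(n * (a + ε / 2))) := by
    rw [← Real.exp_add]
    ring_nf
  rw [h3]
  refine mul_le_mul_of_nonneg_right ?_ (Real.exp_pos _).le
  simpa using h2.le

lemma hasErrorExponent_of_bounds {μ π : Y → ℝ} {M : ℕ} {δ : Test Y M} {a C : ℝ} (K : ℕ)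
    (hC : 0 < C)
    (hlow : ∀ ε : ℝ, 0 < ε → ∀ᶠ n : ℕ in atTop, Real.exp (-(n * (a + ε))) ≤ maxError μ π δ n)
    (hup : ∀ᶠ n : ℕ in atTop,
      maxError μ π δ n ≤ C * (((n : ℝ) + 1) ^ K * Real.exp (-(n * a)))) :
    HasErrorExponent μ π δ a := by
  refine Metric.tendsto_atTop'.2 fun ε hε => ?_
  have hev : ∀ᶠ n : ℕ in atTop, dist (errorRate μ π δ n) a < ε := by
    filter_upwards [hlow _ (half_pos hε), hup, eventually_gt_atTop 0,
      (tendsto_pow_mul_exp K (half_pos hε)).eventually (gt_mem_nhds (inv_pos.2 hC))]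
      with n h1 h2 hn h3
    have h4 := errorRate_le_of_exp_le hn h1
    have h5 : a - ε / 2 ≤ errorRate μ π δ n := by
      refine le_errorRate_of_le_exp hn ((Real.exp_pos _).trans_le h1) (h2.trans ?_)
      have h6 : Real.exp (-(n * a)) = Real.exp (-(n * (ε / 2))) * Real.exp (-(n * (a - ε / 2))) := by
        rw [← Real.exp_add]
        ring_nf
      rw [h6, ← mul_assoc, ← mul_assoc, mul_assoc C]
      have h7 : C * (((n : ℝ) + 1) ^ K * Real.exp (-(n * (ε / 2)))) ≤ 1 := by
        have := mul_le_mul_of_nonneg_left h3.le hC.le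
        rwa [mul_inv_cancel₀ hC.ne'] at this
      exact mul_le_of_le_one_left (Real.exp_pos _).le h7
    rw [Real.dist_eq, abs_lt]
    constructor <;> linarith
  obtain ⟨N, hN⟩ := eventually_atTop.1 hev
  exact ⟨N, fun n hn => hN n hn.le⟩

section KnownLaws

variable {μ π : Y → ℝ}

/-- The normalized geometric mean of two pmfs. -/
noncomputable def geometricMixture (μ π : Y → ℝ) (y : Y) : ℝ :=
  √(μ y) * √(π y) / ∑ z, √(μ z) * √(π z)

lemma geometricMixture_mem_stdSimplex (hμ_pos : ∀ y, 0 < μ y) (hπ : π ∈ stdSimplex ℝ Y) :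
    geometricMixture μ π ∈ stdSimplex ℝ Y := by
  have h := sum_sqrt_pos hμ_pos hπ
  refine ⟨fun y => by unfold geometricMixture; positivity, ?_⟩
  simp only [geometricMixture]
  rw [← Finset.sum_div, div_self h.ne']

lemma relEntropy_geometricMixture (hμ_pos : ∀ y, 0 < μ y) (hπ : π ∈ stdSimplex ℝ Y)
    (hπ_pos : ∀ y, 0 < π y) :
    relEntropy (geometricMixture μ π) μ + relEntropy (geometricMixture μ π) π
      = 2 * bhattacharyya μ π := by
  have hg := geometricMixture_mem_stdSimplex hμ_pos hπ
  have hZ := sum_sqrt_pos hμ_pos hπ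
  have key : ∀ y, Real.log (geometricMixture μ π y / μ y) + Real.log (geometricMixture μ π y / π y)
      = 2 * bhattacharyya μ π := by
    intro y
    have h1 := hμ_pos y
    have h2 := hπ_pos y
    have h3 : Real.log (geometricMixture μ π y) =
        Real.log (μ y) / 2 + Real.log (π y) / 2 + bhattacharyya μ π := by
      rw [geometricMixture, Real.log_div (by positivity) hZ.ne',
        Real.log_mul (by positivity) (by positivity), Real.log_sqrt h1.le, Real.log_sqrt h2.le,
        bhattacharyya]
      ring
    have h4 : geometricMixture μ π y ≠ 0 := by
      unfold geometricMixture
      positivity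
    rw [Real.log_div h4 h1.ne', Real.log_div h4 h2.ne', h3]
    ring
  simp only [relEntropy]
  rw [← Finset.sum_add_distrib]
  simp only [← mul_add, key]
  rw [← Finset.sum_mul, hg.2, one_mul]

lemma eventually_exp_bhattacharyya_le_maxError [DecidableEq Y] (hμ_pos : ∀ y, 0 < μ y)
    (hπ : π ∈ stdSimplex ℝ Y) (hπ_pos : ∀ y, 0 < π y) {M : ℕ} {i j : Fin M} (hij : i ≠ j) (δ : Test Y M) {ε : ℝ}
    (hε : 0 < ε) :
    ∀ᶠ n : ℕ in atTop,
      Real.exp (-(n * (2 * bhattacharyya μ π + ε))) ≤ maxError μ π δ n := by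
  set g := geometricMixture μ π with hg
  have hgm : g ∈ stdSimplex ℝ Y := geometricMixture_mem_stdSimplex hμ_pos hπ
  set q : Fin M → Y → ℝ := fun l => if l = i ∨ l = j then g else π with hq
  have hqm : ∀ l, q l ∈ stdSimplex ℝ Y := fun l => by
    simp only [hq]; split_ifs
    exacts [hgm, hπ]
  have hqi : q i = g := by simp [hq]
  have hqj : q j = g := by simp [hq]
  have hql : ∀ l, l ≠ i ∧ l ≠ j → q l = π := fun l hl => by simp [hq, hl.1, hl.2]
  have hDi : ∑ l, relEntropy (q l) (hypLaw μ π i l) = 2 * bhattacharyya μ π := by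
    rw [Fintype.sum_eq_add i j hij fun l hl => by
      rw [hql l hl, hypLaw_of_ne _ _ hl.1, relEntropy_self], hqi, hqj, hypLaw_self,
      hypLaw_of_ne _ _ hij.symm, relEntropy_geometricMixture hμ_pos hπ hπ_pos]
  have hDj : ∑ l, relEntropy (q l) (hypLaw μ π j l) = 2 * bhattacharyya μ π := by
    rw [Fintype.sum_eq_add i j hij fun l hl => by
      rw [hql l hl, hypLaw_of_ne _ _ hl.2, relEntropy_self], hqi, hqj, hypLaw_self,
      hypLaw_of_ne _ _ hij, add_comm, relEntropy_geometricMixture hμ_pos hπ hπ_pos]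
  refine eventually_exp_le_maxError (c := 1 / 2 / 2) (by norm_num) hε fun ε hε => ?_
  filter_upwards [eventually_le_sum_productProb (hypLaw_pos hμ_pos hπ_pos i) hqm
      (c := 1 / 2) (by norm_num) hε,
    eventually_le_sum_productProb (hypLaw_pos hμ_pos hπ_pos j) hqm
      (c := 1 / 2) (by norm_num) hε] with n hi hj
  rw [hDi] at hi
  rw [hDj] at hj
  have hsum : 1 ≤ ∑ x : Sample Y M n with δ n x ≠ i, productProb q x +
      ∑ x : Sample Y M n with δ n x ≠ j, productProb q x := by
    rw [← sum_productProb_eq_one (n := n) hqm, Finset.sum_filter, Finset.sum_filter,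
      ← Finset.sum_add_distrib]
    refine Finset.sum_le_sum fun x _ => ?_
    have := productProb_nonneg (fun l => (hqm l).1) x
    by_cases h : δ n x = i
    · have : δ n x ≠ j := h ▸ hij
      simp [h, hij]
    · rw [if_pos h]
      split_ifs <;> linarith
  rcases le_total (1 / 2) (∑ x : Sample Y M n with δ n x ≠ i, productProb q x) with h | h
  · exact (hi _ h).trans (sum_productProb_le_maxError μ π δ n i)
  · exact (hj _ (by linarith)).trans (sum_productProb_le_maxError μ π δ n j)

lemma sum_sqrt_productProb (hμ : ∀ y, 0 ≤ μ y) (hπ : π ∈ stdSimplex ℝ Y) {M n : ℕ}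
    {i j : Fin M} (hij : i ≠ j) :
    ∑ x : Sample Y M n, √(productProb (hypLaw μ π i) x) * √(productProb (hypLaw μ π j) x)
      = (∑ y, √(μ y) * √(π y)) ^ (2 * n) := by
  have hnn : ∀ i k : Fin M, ∀ y, 0 ≤ hypLaw μ π i k y := fun i k y => by
    by_cases h : k = i
    · rw [h, hypLaw_self]; exact hμ y
    · rw [hypLaw_of_ne _ _ h]; exact hπ.1 y
  have h1 : ∀ (i : Fin M) (x : Sample Y M n), √(productProb (hypLaw μ π i) x) =
      productProb (fun k y => √(hypLaw μ π i k y)) x := fun i x => by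
    rw [Real.sqrt_eq_iff_mul_self_eq (productProb_nonneg (hnn i) x)
      (productProb_nonneg (fun _ _ => Real.sqrt_nonneg _) x)]
    simp only [productProb, ← Finset.prod_mul_distrib, Real.mul_self_sqrt (hnn _ _ _)]
  have h2 : ∀ x : Sample Y M n,
      √(productProb (hypLaw μ π i) x) * √(productProb (hypLaw μ π j) x) =
      productProb (fun k y => √(hypLaw μ π i k y) * √(hypLaw μ π j k y)) x := fun x => by
    rw [h1, h1]
    simp only [productProb, ← Finset.prod_mul_distrib]
  simp only [h2]
  rw [sum_productProb, Fintype.prod_eq_mul i j hij fun k hk => by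
    rw [hypLaw_of_ne _ _ hk.1, hypLaw_of_ne _ _ hk.2]
    simp only [Real.mul_self_sqrt (hπ.1 _), hπ.2, one_pow]]
  rw [hypLaw_self, hypLaw_self, hypLaw_of_ne _ _ hij, hypLaw_of_ne _ _ hij.symm, two_mul, pow_add]
  simp only [mul_comm (√(π _))]

lemma isOptimalExponent [DecidableEq Y] (hμ_pos : ∀ y, 0 < μ y)
    (hπ : π ∈ stdSimplex ℝ Y) (hπ_pos : ∀ y, 0 < π y) {M : ℕ} (hM : 3 ≤ M) :
    IsOptimalExponent μ π M (2 * bhattacharyya μ π) := by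
  have : Nonempty (Fin M) := ⟨⟨0, by omega⟩⟩
  have hconv : ∀ δ : Test Y M, ∀ ε : ℝ, 0 < ε → ∀ᶠ n : ℕ in atTop,
      Real.exp (-(n * (2 * bhattacharyya μ π + ε))) ≤ maxError μ π δ n := fun δ ε hε =>
    eventually_exp_bhattacharyya_le_maxError hμ_pos hπ hπ_pos (i := ⟨0, by omega⟩)
      (j := ⟨1, by omega⟩) (by simp) δ hε
  refine ⟨?_, fun δ ε hε => ?_⟩
  · choose δ hδ using fun (n : ℕ) (x : Sample Y M n) =>
      Finite.exists_max fun i : Fin M => productProb (hypLaw μ π i) x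
    refine ⟨δ, hasErrorExponent_of_bounds 0 (C := M) (by exact_mod_cast (by omega : 0 < M))
      (hconv δ) (Eventually.of_forall fun n => maxError_le fun i => ?_)⟩
    have hnn : ∀ (j : Fin M) (x : Sample Y M n), 0 ≤ productProb (hypLaw μ π j) x := fun j x =>
      productProb_nonneg (fun k y => (hypLaw_pos hμ_pos hπ_pos j k y).le) x
    have hZ := sum_sqrt_pos hμ_pos hπ
    calc ∑ x : Sample Y M n with δ n x ≠ i, productProb (hypLaw μ π i) x
        ≤ ∑ x : Sample Y M n with δ n x ≠ i, ∑ j ∈ Finset.univ.erase i,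
          √(productProb (hypLaw μ π i) x) * √(productProb (hypLaw μ π j) x) := by
          refine Finset.sum_le_sum fun x hx => ?_
          refine le_trans ?_ (Finset.single_le_sum
            (f := fun j => √(productProb (hypLaw μ π i) x) * √(productProb (hypLaw μ π j) x))
            (fun j _ => by positivity)
            (Finset.mem_erase.2 ⟨(Finset.mem_filter.1 hx).2, Finset.mem_univ _⟩))
          calc productProb (hypLaw μ π i) x
              = √(productProb (hypLaw μ π i) x) * √(productProb (hypLaw μ π i) x) :=
                (Real.mul_self_sqrt (hnn i x)).symm
            _ ≤ _ := mul_le_mul_of_nonneg_left (Real.sqrt_le_sqrt (hδ n x i))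
                (Real.sqrt_nonneg _)
      _ ≤ ∑ x : Sample Y M n, ∑ j ∈ Finset.univ.erase i,
          √(productProb (hypLaw μ π i) x) * √(productProb (hypLaw μ π j) x) :=
          Finset.sum_le_univ_sum_of_nonneg fun x => Finset.sum_nonneg fun j _ => by positivity
      _ = ∑ j ∈ Finset.univ.erase i, (∑ y, √(μ y) * √(π y)) ^ (2 * n) := by
          rw [Finset.sum_comm]
          exact Finset.sum_congr rfl fun j hj => sum_sqrt_productProb (fun y => (hμ_pos y).le) hπ
            (Finset.ne_of_mem_erase hj).symm
      _ ≤ M * (((n : ℝ) + 1) ^ 0 * Real.exp (-(n * (2 * bhattacharyya μ π)))) := by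
          have h1 : Real.exp (-(n * (2 * bhattacharyya μ π))) =
              (∑ y, √(μ y) * √(π y)) ^ (2 * n) := by
            rw [bhattacharyya, ← Real.rpow_natCast, Real.rpow_def_of_pos hZ]
            push_cast
            ring_nf
          rw [h1, pow_zero, one_mul, Finset.sum_const, nsmul_eq_mul]
          refine mul_le_mul_of_nonneg_right ?_ (by positivity)
          exact_mod_cast (Finset.card_le_univ _).trans (by simp)
  · filter_upwards [hconv δ ε hε, eventually_gt_atTop 0] with n h hn
    exact errorRate_le_of_exp_le hn h

end KnownLaws

end Hypotheses

section UniversalTest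

variable {Y : Type*}

lemma eq_zero_of_average_eq_zero {N : ℝ} {m p : Y → ℝ} (hN : 0 < N)
    (hm : ∀ y, 0 ≤ m y) (hp : ∀ y, 0 ≤ p y) {y : Y}
    (h : (N * m y + p y) / (N + 1) = 0) : m y = 0 ∧ p y = 0 := by
  have h1 : N * m y + p y = 0 := by
    rcases div_eq_zero_iff.1 h with h | h
    · exact h
    · linarith
  have h2 := mul_nonneg hN.le (hm y)
  have h3 := hp y
  exact ⟨(mul_eq_zero.1 (by linarith : N * m y = 0)).resolve_left hN.ne', by linarith⟩

lemma sum_erase_erase_update {M : ℕ} {β : Type*} [AddCommMonoid β] (γ : Fin M → Y → ℝ)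
    {i j l : Fin M} (hl : l = i ∨ l = j) (p : Y → ℝ) (f : (Y → ℝ) → β) :
    ∑ k ∈ (Finset.univ.erase i).erase j, f (Function.update γ l p k) =
      ∑ k ∈ (Finset.univ.erase i).erase j, f (γ k) := by
  refine Finset.sum_congr rfl fun k hk => ?_
  rw [Function.update_of_ne]
  simp only [Finset.mem_erase] at hk
  rcases hl with rfl | rfl
  exacts [hk.2.1, hk.1]

/-- The average of the coordinates other than `i` and `j`. -/
noncomputable def avgExceptTwo {M : ℕ} (γ : Fin M → Y → ℝ) (i j : Fin M) : Y → ℝ :=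
  fun y => (∑ k ∈ (Finset.univ.erase i).erase j, γ k y) / ((M : ℝ) - 2)

lemma avgExceptTwo_comm {M : ℕ} (γ : Fin M → Y → ℝ) (i j : Fin M) :
    avgExceptTwo γ i j = avgExceptTwo γ j i := by
  funext y
  rw [avgExceptTwo, avgExceptTwo, Finset.erase_right_comm]

lemma avgExceptTwo_update {M : ℕ} (γ : Fin M → Y → ℝ) {i j l : Fin M} (hl : l = i ∨ l = j)
    (p : Y → ℝ) : avgExceptTwo (Function.update γ l p) i j = avgExceptTwo γ i j := by
  funext y
  simp only [avgExceptTwo, sum_erase_erase_update γ hl p fun q => q y]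

variable [Fintype Y]

/-- The statistic `U_i^univ` as a function of the empirical distributions of the coordinates. -/
noncomputable def typeStat {M : ℕ} (γ : Fin M → Y → ℝ) (i : Fin M) : ℝ :=
  ∑ j ∈ Finset.univ.erase i,
    relEntropy (γ j) fun y => (∑ k ∈ Finset.univ.erase i, γ k y) / ((M : ℝ) - 1)

lemma univStat_eq_typeStat [DecidableEq Y] {M n : ℕ} (x : Sample Y M n) (i : Fin M) :
    univStat x i = typeStat (fun j => empirical (x j)) i := rfl

/-- An expression for `typeStat` that is continuous everywhere. -/
lemma typeStat_eq_sum_mul_log {M : ℕ} (hM : 3 ≤ M) {γ : Fin M → Y → ℝ} (hγ : ∀ k y, 0 ≤ γ k y)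
    (i : Fin M) :
    typeStat γ i = ∑ y, (∑ k ∈ Finset.univ.erase i, γ k y * Real.log (γ k y) -
      ((M : ℝ) - 1) * ((∑ k ∈ Finset.univ.erase i, γ k y) / ((M : ℝ) - 1) *
        Real.log ((∑ k ∈ Finset.univ.erase i, γ k y) / ((M : ℝ) - 1)))) := by
  have hM' : (0 : ℝ) < (M : ℝ) - 1 := by
    have : (3 : ℝ) ≤ M := by exact_mod_cast hM
    linarith
  simp only [typeStat, relEntropy]
  rw [Finset.sum_comm]
  refine Finset.sum_congr rfl fun y _ => ?_
  rw [← mul_assoc, mul_div_cancel₀ _ hM'.ne', Finset.sum_mul, ← Finset.sum_sub_distrib]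
  refine Finset.sum_congr rfl fun k hk => ?_
  rcases (hγ k y).eq_or_lt with h | h
  · simp [← h]
  have h2 : 0 < ∑ k ∈ Finset.univ.erase i, γ k y :=
    Finset.sum_pos' (fun k _ => hγ k y) ⟨k, hk, h⟩
  rw [Real.log_div h.ne' (by positivity)]
  ring

lemma exists_typeStat_lt_of_close {M : ℕ} (hM : 3 ≤ M) {γ : Fin M → Y → ℝ}
    (hγ : ∀ k y, 0 ≤ γ k y) {i j : Fin M} (h : typeStat γ j < typeStat γ i) :
    ∃ η > 0, ∀ γ' : Fin M → Y → ℝ, (∀ k y, 0 ≤ γ' k y) → (∀ k y, |γ' k y - γ k y| < η) →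
      typeStat γ' j < typeStat γ' i := by
  set F : Fin M → (Fin M → Y → ℝ) → ℝ := fun i γ =>
    ∑ y, (∑ k ∈ Finset.univ.erase i, γ k y * Real.log (γ k y) -
      ((M : ℝ) - 1) * ((∑ k ∈ Finset.univ.erase i, γ k y) / ((M : ℝ) - 1) *
        Real.log ((∑ k ∈ Finset.univ.erase i, γ k y) / ((M : ℝ) - 1)))) with hF
  have hFc : ∀ i, Continuous (F i) := by
    intro i
    refine continuous_finsetSum _ fun y _ => Continuous.sub ?_ (continuous_const.mul ?_)
    · exact continuous_finsetSum _ fun k _ =>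
        Real.continuous_mul_log.comp (continuous_apply_apply k y)
    · exact Real.continuous_mul_log.comp
        ((continuous_finsetSum _ fun k _ => continuous_apply_apply k y).div_const _)
  have hFs : ∀ γ : Fin M → Y → ℝ, (∀ k y, 0 ≤ γ k y) → ∀ l, typeStat γ l = F l γ :=
    fun γ hγ l => typeStat_eq_sum_mul_log hM hγ l
  have ho : IsOpen {γ | F j γ < F i γ} := isOpen_lt (hFc j) (hFc i)
  have hmem : γ ∈ {γ | F j γ < F i γ} := by
    rwa [Set.mem_ofPred_eq, ← hFs γ hγ, ← hFs γ hγ]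
  obtain ⟨η, hη, hball⟩ := Metric.isOpen_iff.1 ho γ hmem
  refine ⟨η, hη, fun γ' hγ' hd => ?_⟩
  have : γ' ∈ Metric.ball γ η := by
    rw [Metric.mem_ball, dist_pi_lt_iff hη]
    intro k
    rw [dist_pi_lt_iff hη]
    exact fun y => hd k y
  rw [hFs γ' hγ', hFs γ' hγ']
  exact hball this

/-- The part of `typeStat` that depends on one of the averaged coordinates, when the other `N`
averaged coordinates have average `m`. -/
noncomputable def mixGap (N : ℝ) (m p : Y → ℝ) : ℝ :=
  N * relEntropy m (fun y => (N * m y + p y) / (N + 1)) +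
    relEntropy p (fun y => (N * m y + p y) / (N + 1))

section MixGap

variable {N : ℝ} {m p : Y → ℝ}

lemma average_mem_stdSimplex (hN : 0 < N) (hm : m ∈ stdSimplex ℝ Y) (hp : p ∈ stdSimplex ℝ Y) :
    (fun y => (N * m y + p y) / (N + 1)) ∈ stdSimplex ℝ Y := by
  refine ⟨fun y => ?_, ?_⟩
  · have := hm.1 y
    have := hp.1 y
    positivity
  · rw [← Finset.sum_div, Finset.sum_add_distrib, ← Finset.mul_sum, hm.2, hp.2, mul_one,
      div_self (by positivity)]

lemma mixGap_self (hN : 0 < N) : mixGap N m m = 0 := by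
  have : (fun y => (N * m y + m y) / (N + 1)) = m := by
    funext y
    field_simp
  rw [mixGap, this, relEntropy_self]
  simp

lemma mixGap_pos (hN : 0 < N) (hm : m ∈ stdSimplex ℝ Y) (hp : p ∈ stdSimplex ℝ Y) (h : p ≠ m) :
    0 < mixGap N m p := by
  have ha := average_mem_stdSimplex hN hm hp
  have h1 := relEntropy_nonneg hm ha fun y hy => (eq_zero_of_average_eq_zero hN hm.1 hp.1 hy).1
  have h2 : 0 < relEntropy p (fun y => (N * m y + p y) / (N + 1)) := by
    refine relEntropy_pos hp ha
      (fun y hy => (eq_zero_of_average_eq_zero hN hm.1 hp.1 hy).2) fun e => h ?_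
    funext y
    have : p y = (N * m y + p y) / (N + 1) := congrFun e y
    rw [eq_div_iff (by positivity)] at this
    exact mul_left_cancel₀ hN.ne' (by linarith)
  have := mul_nonneg hN.le h1
  exact add_pos_of_nonneg_of_pos this h2

lemma mixGap_mix_le (hN : 0 < N) (hm : m ∈ stdSimplex ℝ Y) (hp : p ∈ stdSimplex ℝ Y) {t : ℝ}
    (ht0 : 0 ≤ t) (ht1 : t < 1) :
    mixGap N m (fun y => (1 - t) * p y + t * m y) ≤ (1 - t) * mixGap N m p := by
  have ha := average_mem_stdSimplex hN hm hp
  have h1 : (fun y => (N * m y + ((1 - t) * p y + t * m y)) / (N + 1)) =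
      fun y => (1 - t) * ((N * m y + p y) / (N + 1)) + t * m y := by
    funext y
    field_simp
    ring
  have h2 : m = fun y => (1 - t) * m y + t * m y := by
    funext y
    ring
  have h3 := relEntropy_mix_le hm.1 ha.1 hm.1
    (fun y hy => (eq_zero_of_average_eq_zero hN hm.1 hp.1 hy).1) ht0 ht1
  have h4 := relEntropy_mix_le hp.1 ha.1 hm.1
    (fun y hy => (eq_zero_of_average_eq_zero hN hm.1 hp.1 hy).2) ht0 ht1
  rw [← h2] at h3
  simp only [mixGap]
  rw [h1]
  nlinarith [mul_le_mul_of_nonneg_left h3 hN.le]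

end MixGap

lemma card_erase_erase {M : ℕ} {i j : Fin M} (hij : i ≠ j) (hM : 3 ≤ M) :
    (((Finset.univ.erase i).erase j).card : ℝ) = (M : ℝ) - 2 := by
  rw [Finset.card_erase_of_mem (by simp [hij.symm]), Finset.card_erase_of_mem (by simp)]
  simp only [Finset.card_univ, Fintype.card_fin]
  rw [Nat.sub_sub, Nat.cast_sub (by omega)]
  norm_num

lemma natCast_sub_two_pos {M : ℕ} (hM : 3 ≤ M) : (0 : ℝ) < (M : ℝ) - 2 := by
  have : (3 : ℝ) ≤ M := by exact_mod_cast hM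
  linarith

lemma avgExceptTwo_mem_stdSimplex {M : ℕ} (hM : 3 ≤ M) {γ : Fin M → Y → ℝ}
    (hγ : ∀ k, γ k ∈ stdSimplex ℝ Y) {i j : Fin M} (hij : i ≠ j) :
    avgExceptTwo γ i j ∈ stdSimplex ℝ Y := by
  have hN := natCast_sub_two_pos hM
  refine ⟨fun y => div_nonneg (Finset.sum_nonneg fun k _ => (hγ k).1 y) hN.le, ?_⟩
  simp only [avgExceptTwo]
  rw [← Finset.sum_div, Finset.sum_comm, Finset.sum_congr rfl fun k _ => (hγ k).2,
    Finset.sum_const, nsmul_eq_mul, mul_one, card_erase_erase hij hM, div_self hN.ne']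

lemma typeStat_eq_add_mixGap {M : ℕ} (hM : 3 ≤ M) {γ : Fin M → Y → ℝ}
    (hγ : ∀ k y, 0 ≤ γ k y) {i j : Fin M} (hij : i ≠ j) :
    typeStat γ j = ∑ k ∈ (Finset.univ.erase i).erase j, relEntropy (γ k) (avgExceptTwo γ i j) +
      mixGap ((M : ℝ) - 2) (avgExceptTwo γ i j) (γ i) := by
  have hN := natCast_sub_two_pos hM
  set m := avgExceptTwo γ i j with hm
  have hm0 : ∀ y, 0 ≤ m y := fun y => div_nonneg (Finset.sum_nonneg fun k _ => hγ k y) hN.le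
  have hi : i ∈ Finset.univ.erase j := by simp [hij]
  have ha : (fun y => (∑ k ∈ Finset.univ.erase j, γ k y) / ((M : ℝ) - 1)) =
      fun y => (((M : ℝ) - 2) * m y + γ i y) / ((M : ℝ) - 2 + 1) := by
    funext y
    rw [← Finset.sum_erase_add _ _ hi, hm, avgExceptTwo, mul_div_cancel₀ _ hN.ne',
      Finset.erase_right_comm]
    ring_nf
  rw [typeStat, ha, ← Finset.sum_erase_add _ _ hi, Finset.erase_right_comm,
    sum_relEntropy_eq hN (fun k _ => hγ k) (fun y => rfl) fun y hy =>
      (eq_zero_of_average_eq_zero hN hm0 (hγ i) hy).1, mixGap]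
  exact add_assoc _ _ _

lemma update_mem_stdSimplex {M : ℕ} {γ : Fin M → Y → ℝ} (hγ : ∀ k, γ k ∈ stdSimplex ℝ Y)
    (l : Fin M) {p : Y → ℝ} (hp : p ∈ stdSimplex ℝ Y) (k : Fin M) :
    Function.update γ l p k ∈ stdSimplex ℝ Y := by
  by_cases h : k = l
  · subst h; rwa [Function.update_self]
  · rw [Function.update_of_ne h]; exact hγ k

lemma mix_mem_stdSimplex {p w : Y → ℝ} (hp : p ∈ stdSimplex ℝ Y) (hw : w ∈ stdSimplex ℝ Y)
    {t : ℝ} (ht0 : 0 ≤ t) (ht1 : t ≤ 1) :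
    (fun y => (1 - t) * p y + t * w y) ∈ stdSimplex ℝ Y := by
  refine ⟨fun y => add_nonneg (mul_nonneg (by linarith) (hp.1 y)) (mul_nonneg ht0 (hw.1 y)), ?_⟩
  rw [Finset.sum_add_distrib, ← Finset.mul_sum, ← Finset.mul_sum, hp.2, hw.2]
  ring

/-- A tuple at which the statistics of `i` and `j` are tied has a coordinate that can be moved
towards a pmf `w` so that `j` wins strictly. -/
lemma exists_direction {M : ℕ} (hM : 3 ≤ M) {γ : Fin M → Y → ℝ}
    (hγ : ∀ k, γ k ∈ stdSimplex ℝ Y) {i j : Fin M} (hij : i ≠ j)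
    (h : typeStat γ j ≤ typeStat γ i)
    {p₁ p₂ : Y → ℝ} (hp₁ : p₁ ∈ stdSimplex ℝ Y) (hp₂ : p₂ ∈ stdSimplex ℝ Y) (hne : p₁ ≠ p₂) :
    ∃ l, ∃ w ∈ stdSimplex ℝ Y, ∀ t : ℝ, 0 < t → t < 1 →
      typeStat (Function.update γ l fun y => (1 - t) * γ l y + t * w y) j <
        typeStat (Function.update γ l fun y => (1 - t) * γ l y + t * w y) i := by
  have hN := natCast_sub_two_pos hM
  set m := avgExceptTwo γ i j with hm
  have hmm : m ∈ stdSimplex ℝ Y := avgExceptTwo_mem_stdSimplex hM hγ hij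
  set c := ∑ k ∈ (Finset.univ.erase i).erase j, relEntropy (γ k) m with hc
  have hstat : ∀ l, l = i ∨ l = j → ∀ p ∈ stdSimplex ℝ Y,
      typeStat (Function.update γ l p) j =
        c + mixGap ((M : ℝ) - 2) m (Function.update γ l p i) ∧
      typeStat (Function.update γ l p) i =
        c + mixGap ((M : ℝ) - 2) m (Function.update γ l p j) := by
    intro l hl p hp
    have hu := fun k => (update_mem_stdSimplex hγ l hp k).1
    constructor
    · rw [typeStat_eq_add_mixGap hM hu hij, avgExceptTwo_update γ hl, ← hm,
        sum_erase_erase_update γ hl p fun q => relEntropy q m]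
    · rw [typeStat_eq_add_mixGap hM hu hij.symm, avgExceptTwo_comm, avgExceptTwo_update γ hl,
        ← hm, Finset.erase_right_comm, sum_erase_erase_update γ hl p fun q => relEntropy q m]
  have hj : typeStat γ j = c + mixGap ((M : ℝ) - 2) m (γ i) :=
    typeStat_eq_add_mixGap hM (fun k => (hγ k).1) hij
  have hi : typeStat γ i = c + mixGap ((M : ℝ) - 2) m (γ j) := by
    rw [typeStat_eq_add_mixGap hM (fun k => (hγ k).1) hij.symm, avgExceptTwo_comm,
      Finset.erase_right_comm]
  by_cases him : γ i = m
  · by_cases hjm : γ j = m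
    · obtain ⟨w, hw, hwm⟩ : ∃ w ∈ stdSimplex ℝ Y, w ≠ m := by
        by_cases h1 : p₁ = m
        · exact ⟨p₂, hp₂, fun e => hne (h1.trans e.symm)⟩
        · exact ⟨p₁, hp₁, h1⟩
      refine ⟨j, w, hw, fun t ht0 ht1 => ?_⟩
      have hmix := mix_mem_stdSimplex (hγ j) hw ht0.le ht1.le
      obtain ⟨h1, h2⟩ := hstat j (Or.inr rfl) _ hmix
      rw [h1, h2, Function.update_self, Function.update_of_ne hij, him, mixGap_self hN]
      refine add_lt_add_right (mixGap_pos hN hmm hmix fun e => hwm ?_) c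
      funext y
      have := congrFun e y
      rw [hjm] at this
      exact mul_left_cancel₀ ht0.ne' (by linarith)
    · refine ⟨i, m, hmm, fun t ht0 ht1 => ?_⟩
      have hmix := mix_mem_stdSimplex (hγ i) hmm ht0.le ht1.le
      obtain ⟨h1, h2⟩ := hstat i (Or.inl rfl) _ hmix
      have h3 : (fun y => (1 - t) * γ i y + t * m y) = m := by
        funext y
        rw [him]
        ring
      rw [h1, h2, Function.update_self, Function.update_of_ne hij.symm, h3, mixGap_self hN]
      exact add_lt_add_right (mixGap_pos hN hmm (hγ j) hjm) c
  · refine ⟨i, m, hmm, fun t ht0 ht1 => ?_⟩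
    have hmix := mix_mem_stdSimplex (hγ i) hmm ht0.le ht1.le
    obtain ⟨h1, h2⟩ := hstat i (Or.inl rfl) _ hmix
    rw [h1, h2, Function.update_self, Function.update_of_ne hij.symm]
    have h3 := mixGap_mix_le hN hmm (hγ i) ht0.le ht1
    have h4 := mixGap_pos hN hmm (hγ i) him
    nlinarith

lemma exists_typeStat_lt {M : ℕ} (hM : 3 ≤ M) {γ : Fin M → Y → ℝ}
    (hγ : ∀ k, γ k ∈ stdSimplex ℝ Y) {i j : Fin M} (hij : i ≠ j)
    (h : typeStat γ j ≤ typeStat γ i)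
    {p₁ p₂ : Y → ℝ} (hp₁ : p₁ ∈ stdSimplex ℝ Y) (hp₂ : p₂ ∈ stdSimplex ℝ Y) (hne : p₁ ≠ p₂)
    {f : (Fin M → Y → ℝ) → ℝ} (hf : Continuous f) {ε : ℝ} (hε : 0 < ε) :
    ∃ γ' : Fin M → Y → ℝ, (∀ k, γ' k ∈ stdSimplex ℝ Y) ∧ typeStat γ' j < typeStat γ' i ∧
      f γ' < f γ + ε := by
  obtain ⟨l, w, hw, hdir⟩ := exists_direction hM hγ hij h hp₁ hp₂ hne
  set c : ℝ → Fin M → Y → ℝ := fun t =>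
    Function.update γ l fun y => (1 - t) * γ l y + t * w y with hc
  have hcont : Continuous fun t => f (c t) := by
    refine hf.comp (continuous_const.update l ?_)
    fun_prop
  have hc0 : c 0 = γ := by
    rw [hc]
    simp
  have h1 : ∀ᶠ t in 𝓝 (0 : ℝ), f (c t) < f γ + ε := by
    refine (hcont.tendsto 0).eventually (gt_mem_nhds ?_)
    rw [hc0]
    linarith
  have h2 : ∀ᶠ t in 𝓝[>] (0 : ℝ), f (c t) < f γ + ε ∧ t ∈ Set.Ioo (0 : ℝ) 1 :=
    (h1.filter_mono nhdsWithin_le_nhds).and (Ioo_mem_nhdsGT one_pos)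
  obtain ⟨t, ht, ht0, ht1⟩ := h2.exists
  exact ⟨c t, update_mem_stdSimplex hγ l (mix_mem_stdSimplex (hγ l) hw ht0.le ht1.le),
    hdir t ht0 ht1, ht⟩

/-- The rates at which tuples of empirical distributions occur that may lead the universal test
to an error. -/
def errorRates (μ π : Y → ℝ) (M : ℕ) : Set ℝ :=
  {r | ∃ i j : Fin M, i ≠ j ∧ ∃ γ : Fin M → Y → ℝ, (∀ k, γ k ∈ stdSimplex ℝ Y) ∧
    typeStat γ j ≤ typeStat γ i ∧ r = ∑ k, relEntropy (γ k) (hypLaw μ π i k)}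

/-- The error exponent of the universal test. -/
noncomputable def universalExponent (μ π : Y → ℝ) (M : ℕ) : ℝ :=
  sInf (errorRates μ π M)

section Exponent

variable {μ π : Y → ℝ}

lemma errorRates_nonempty (hπ : π ∈ stdSimplex ℝ Y) {M : ℕ} (hM : 3 ≤ M) :
    (errorRates μ π M).Nonempty := by
  have h01 : (⟨0, by omega⟩ : Fin M) ≠ ⟨1, by omega⟩ := by simp
  rcases le_total (typeStat (fun _ : Fin M => π) ⟨0, by omega⟩)
    (typeStat (fun _ : Fin M => π) ⟨1, by omega⟩) with h | h
  · exact ⟨_, _, _, h01.symm, _, fun _ => hπ, h, rfl⟩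
  · exact ⟨_, _, _, h01, _, fun _ => hπ, h, rfl⟩

lemma exponentBound_le_of_mem_errorRates (hμ : μ ∈ stdSimplex ℝ Y) (hμ_pos : ∀ y, 0 < μ y)
    (hπ : π ∈ stdSimplex ℝ Y) (hπ_pos : ∀ y, 0 < π y) {M : ℕ} (hM : 3 ≤ M) {r : ℝ}
    (hr : r ∈ errorRates μ π M) : exponentBound μ π M ≤ r := by
  obtain ⟨i, j, hij, γ, hγ, hst, rfl⟩ := hr
  set r := ∑ k, relEntropy (γ k) (hypLaw μ π i k) with hr
  have hleast := isLeast_exponentBound hμ hμ_pos hπ hπ_pos hM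
  rcases le_total (2 * bhattacharyya μ π) r with hle | hle
  · exact (hleast.2 (two_mul_bhattacharyya_mem_boundValues hμ hπ hπ_pos hM)).trans hle
  have hM' : (0 : ℝ) < (M : ℝ) - 1 := by linarith [natCast_sub_two_pos hM]
  have hπne : ∀ {a : Y → ℝ} (y : Y), π y = 0 → a y = 0 := fun y hy => absurd hy (hπ_pos y).ne'
  set a : Fin M → Y → ℝ := fun l y => (∑ k ∈ Finset.univ.erase l, γ k y) / ((M : ℝ) - 1) with ha
  have ham : ∀ l, a l ∈ stdSimplex ℝ Y := fun l => by
    refine ⟨fun y => div_nonneg (Finset.sum_nonneg fun k _ => (hγ k).1 y) hM'.le, ?_⟩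
    simp only [ha]
    rw [← Finset.sum_div, Finset.sum_comm, Finset.sum_congr rfl fun k _ => (hγ k).2,
      Finset.sum_const, nsmul_eq_mul, mul_one, Finset.card_erase_of_mem (Finset.mem_univ l),
      Finset.card_univ, Fintype.card_fin, Nat.cast_sub (by omega), Nat.cast_one,
      div_self hM'.ne']
  have hac : ∀ l, ∀ k ∈ Finset.univ.erase l, ∀ y, a l y = 0 → γ k y = 0 := by
    intro l k hk y hy
    have h1 := (div_eq_zero_iff.1 hy).resolve_right hM'.ne'
    exact (Finset.sum_eq_zero_iff_of_nonneg fun k _ => (hγ k).1 y).1 h1 k hk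
  have hcomp : ∀ l, ∑ k ∈ Finset.univ.erase l, relEntropy (γ k) π =
      typeStat γ l + ((M : ℝ) - 1) * relEntropy (a l) π := fun l =>
    sum_relEntropy_eq hM' (fun k _ => (hγ k).1) (fun y => rfl) hπne
  have hD : ∀ k, 0 ≤ relEntropy (γ k) π := fun k => relEntropy_nonneg (hγ k) hπ hπne
  have hDa : ∀ l, 0 ≤ ((M : ℝ) - 1) * relEntropy (a l) π := fun l =>
    mul_nonneg hM'.le (relEntropy_nonneg (ham l) hπ hπne)
  have hrs : r = relEntropy (γ i) μ + ∑ k ∈ Finset.univ.erase i, relEntropy (γ k) π := by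
    rw [hr, ← Finset.add_sum_erase _ _ (Finset.mem_univ i), hypLaw_self]
    congr 1
    exact Finset.sum_congr rfl fun k hk => by rw [hypLaw_of_ne _ _ (Finset.ne_of_mem_erase hk)]
  have hDi : 0 ≤ relEntropy (γ i) μ :=
    relEntropy_nonneg (hγ i) hμ fun y hy => absurd hy (hμ_pos y).ne'
  have hiU : i ∈ Finset.univ.erase j := by simp [hij]
  have hUnn : ∀ l, ∀ k ∈ Finset.univ.erase l, 0 ≤ relEntropy (γ k) (a l) := fun l k hk =>
    relEntropy_nonneg (hγ k) (ham l) (hac l k hk)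
  have hUj : relEntropy (γ i) (a j) ≤ typeStat γ j :=
    Finset.single_le_sum (f := fun k => relEntropy (γ k) (a j)) (hUnn j) hiU
  have hUj0 : 0 ≤ typeStat γ j := Finset.sum_nonneg (hUnn j)
  refine le_trans (hleast.2 ⟨a j, ⟨ham j, ?_⟩, rfl⟩)
    ((two_mul_bhattacharyya_le (hγ i) hμ_pos (ham j).1 (hac j i hiU)).trans ?_)
  · rw [one_div_mul_eq_div, le_div_iff₀ hM', mul_comm]
    have h1 : ∑ k ∈ Finset.univ.erase j, relEntropy (γ k) π ≤ ∑ k, relEntropy (γ k) π :=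
      Finset.sum_le_univ_sum_of_nonneg hD
    rw [← Finset.add_sum_erase _ _ (Finset.mem_univ i)] at h1
    have h2 := relEntropy_le_logMinConst (hγ i) hπ_pos
    linarith [hcomp j]
  · linarith [hcomp i, hDa i]

lemma bddBelow_errorRates (hμ : μ ∈ stdSimplex ℝ Y) (hμ_pos : ∀ y, 0 < μ y)
    (hπ : π ∈ stdSimplex ℝ Y) (hπ_pos : ∀ y, 0 < π y) {M : ℕ} (hM : 3 ≤ M) :
    BddBelow (errorRates μ π M) :=
  ⟨_, fun _ => exponentBound_le_of_mem_errorRates hμ hμ_pos hπ hπ_pos hM⟩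

lemma exponentBound_le_universalExponent (hμ : μ ∈ stdSimplex ℝ Y) (hμ_pos : ∀ y, 0 < μ y)
    (hπ : π ∈ stdSimplex ℝ Y) (hπ_pos : ∀ y, 0 < π y) {M : ℕ} (hM : 3 ≤ M) :
    exponentBound μ π M ≤ universalExponent μ π M :=
  le_csInf (errorRates_nonempty hπ hM) fun _ =>
    exponentBound_le_of_mem_errorRates hμ hμ_pos hπ hπ_pos hM

lemma eventually_exp_universalExponent_le_maxError [DecidableEq Y] (hμ : μ ∈ stdSimplex ℝ Y)
    (hμ_pos : ∀ y, 0 < μ y) (hπ : π ∈ stdSimplex ℝ Y) (hπ_pos : ∀ y, 0 < π y) (hne : μ ≠ π)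
    {M : ℕ} (hM : 3 ≤ M) {δ : Test Y M} (hδ : IsUniversalTest δ) {ε : ℝ} (hε : 0 < ε) :
    ∀ᶠ n : ℕ in atTop, Real.exp (-(n * (universalExponent μ π M + ε))) ≤ maxError μ π δ n := by
  refine eventually_exp_le_maxError (c := 1 / 2 / 2) (by norm_num) hε fun ε hε => ?_
  obtain ⟨r, ⟨i, j, hij, γ, hγ, hst, rfl⟩, hr⟩ := exists_lt_of_csInf_lt
    (errorRates_nonempty (μ := μ) hπ hM)
    (lt_add_of_pos_right (universalExponent μ π M) (by positivity : 0 < ε / 3))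
  have hcont : Continuous fun γ : Fin M → Y → ℝ => ∑ k, relEntropy (γ k) (hypLaw μ π i k) :=
    continuous_finsetSum _ fun k _ => (continuous_relEntropy_left fun y =>
      (hypLaw_pos hμ_pos hπ_pos i k y).ne').comp (continuous_apply k)
  obtain ⟨q, hq, hlt, hqr⟩ := exists_typeStat_lt hM hγ hij hst hμ hπ hne hcont
    (by positivity : 0 < ε / 3)
  obtain ⟨η, hη, hclose⟩ := exists_typeStat_lt_of_close hM (fun k => (hq k).1) hlt
  filter_upwards [eventually_le_sum_productProb (hypLaw_pos hμ_pos hπ_pos i) hq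
      (c := 1 / 2) (by norm_num) (by positivity : 0 < ε / 3),
    (tendsto_sum_atypical hq hη).eventually (gt_mem_nhds (by norm_num : (0 : ℝ) < 1 / 2))]
    with n h1 h2
  have h3 : 1 / 2 ≤ ∑ x : Sample Y M n with δ n x ≠ i, productProb q x := by
    have h4 : 1 ≤ ∑ x : Sample Y M n with δ n x ≠ i, productProb q x +
        ∑ x ∈ atypical q η n, productProb q x := by
      rw [← sum_productProb_eq_one (n := n) hq, atypical, Finset.sum_filter, Finset.sum_filter,
        ← Finset.sum_add_distrib]
      refine Finset.sum_le_sum fun x _ => ?_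
      have hnn := productProb_nonneg (fun l => (hq l).1) x
      by_cases hx : δ n x = i
      · have hat : ∃ k y, η ≤ |empirical (x k) y - q k y| := by
          by_contra! hcl
          have h5 := hclose _ (fun k => empirical_nonneg (x k)) hcl
          rw [← univStat_eq_typeStat, ← univStat_eq_typeStat] at h5
          have h6 := hδ n x j
          rw [hx] at h6
          exact absurd h6 (not_le.2 h5)
        rw [if_pos hat]
        split_ifs <;> linarith
      · rw [if_pos hx]
        split_ifs <;> linarith
    linarith
  refine le_trans ?_ ((h1 _ h3).trans (sum_productProb_le_maxError μ π δ n i))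
  refine mul_le_mul_of_nonneg_left (Real.exp_le_exp.2 (neg_le_neg ?_)) (by norm_num)
  exact mul_le_mul_of_nonneg_left (by linarith) (Nat.cast_nonneg n)

lemma hasErrorExponent_universalExponent [DecidableEq Y] (hμ : μ ∈ stdSimplex ℝ Y)
    (hμ_pos : ∀ y, 0 < μ y) (hπ : π ∈ stdSimplex ℝ Y) (hπ_pos : ∀ y, 0 < π y) (hne : μ ≠ π)
    {M : ℕ} (hM : 3 ≤ M) {δ : Test Y M} (hδ : IsUniversalTest δ) :
    HasErrorExponent μ π δ (universalExponent μ π M) := by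
  have : Nonempty (Fin M) := ⟨⟨0, by omega⟩⟩
  refine hasErrorExponent_of_bounds (Fintype.card Y * M) one_pos
    (fun ε hε => eventually_exp_universalExponent_le_maxError hμ hμ_pos hπ hπ_pos hne hM hδ hε) ?_
  filter_upwards [eventually_gt_atTop 0] with n hn
  rw [one_mul]
  refine maxError_le fun i => sum_productProb_le hn
    (fun k y => (hypLaw_pos hμ_pos hπ_pos i k y).le) _ fun x hx _ => ?_
  exact csInf_le (bddBelow_errorRates hμ hμ_pos hπ hπ_pos hM)
    ⟨i, δ n x, (Finset.mem_filter.1 hx).2.symm, _, fun k => empirical_mem_stdSimplex hn _,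
      hδ n x i, rfl⟩

lemma universalExponent_le [DecidableEq Y] (hμ : μ ∈ stdSimplex ℝ Y)
    (hμ_pos : ∀ y, 0 < μ y) (hπ : π ∈ stdSimplex ℝ Y) (hπ_pos : ∀ y, 0 < π y) (hne : μ ≠ π)
    {M : ℕ} (hM : 3 ≤ M) {δ : Test Y M} (hδ : IsUniversalTest δ) :
    universalExponent μ π M ≤ 2 * bhattacharyya μ π := by
  refine le_of_forall_pos_le_add fun ε hε => ?_
  exact le_of_tendsto (hasErrorExponent_universalExponent hμ hμ_pos hπ hπ_pos hne hM hδ)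
    ((isOptimalExponent hμ_pos hπ hπ_pos hM).2 δ ε hε)

end Exponent

end UniversalTest

end OutlierTest

theorem theorem3 {Y : Type*} [Fintype Y] [DecidableEq Y]
    (δ : ∀ M : ℕ, 3 ≤ M → OutlierTest.Test Y M)
    (hδ : ∀ (M : ℕ) (hM : 3 ≤ M), OutlierTest.IsUniversalTest (δ M hM))
    (μ π : Y → ℝ) (hμ : μ ∈ stdSimplex ℝ Y) (hπ : π ∈ stdSimplex ℝ Y)
    (hμ_pos : ∀ y, 0 < μ y) (hπ_pos : ∀ y, 0 < π y) (hne : μ ≠ π) :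
    (∀ M : ℕ, 3 ≤ M →
      IsLeast (OutlierTest.boundValues μ π M) (OutlierTest.exponentBound μ π M)) ∧
    MonotoneOn (OutlierTest.exponentBound μ π) (Set.Ici 3) ∧
    Tendsto (OutlierTest.exponentBound μ π) atTop
      (𝓝 (2 * OutlierTest.bhattacharyya μ π)) ∧
    (∃ α : ℕ → ℝ,
      (∀ (M : ℕ) (hM : 3 ≤ M), OutlierTest.HasErrorExponent μ π (δ M hM) (α M) ∧
        OutlierTest.exponentBound μ π M ≤ α M) ∧
      Tendsto α atTop (𝓝 (2 * OutlierTest.bhattacharyya μ π))) ∧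
    (∀ M : ℕ, 3 ≤ M →
      OutlierTest.IsOptimalExponent μ π M (2 * OutlierTest.bhattacharyya μ π)) := by

  refine ⟨fun M hM => OutlierTest.isLeast_exponentBound hμ hμ_pos hπ hπ_pos hM,
    OutlierTest.monotoneOn_exponentBound hμ hμ_pos hπ hπ_pos,
    OutlierTest.tendsto_exponentBound hμ hμ_pos hπ hπ_pos,
    ⟨OutlierTest.universalExponent μ π, fun M hM =>
      ⟨OutlierTest.hasErrorExponent_universalExponent hμ hμ_pos hπ hπ_pos hne hM (hδ M hM),
        OutlierTest.exponentBound_le_universalExponent hμ hμ_pos hπ hπ_pos hM⟩, ?_⟩,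
    fun M hM => OutlierTest.isOptimalExponent hμ_pos hπ hπ_pos hM⟩
  refine tendsto_of_tendsto_of_tendsto_of_le_of_le'
    (OutlierTest.tendsto_exponentBound hμ hμ_pos hπ hπ_pos) tendsto_const_nhds ?_ ?_
  · filter_upwards [eventually_ge_atTop 3] with M hM
    exact OutlierTest.exponentBound_le_universalExponent hμ hμ_pos hπ hπ_pos hM
  · filter_upwards [eventually_ge_atTop 3] with M hM
    exact OutlierTest.universalExponent_le hμ hμ_pos hπ hπ_pos hne hM (hδ M hM)
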